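/- **Decay of correlations.** Equip $\mathbb{Z}^D$ with the $\ell^1$-metric, and write $\operatorname{dist}(X,Y)$ for the distance of two sets (with $\operatorname{dist}(X,Y)=\infty$ and $e^{-\infty}=0$ if one of them is empty), $B_R(x)$ for the closed ball of radius $R$ around $x$, and $|B_R|$ for its cardinality. For a finite $S\subset\mathbb{Z}^D$ let $\mathcal{H}_S=\bigotimes_{x\in S}\mathbb{C}^q$ and let $\mathcal{A}_S$ be the algebra of linear operators on $\mathcal{H}_S$ with the operator norm; for $X\subset S$ identify $A\in\mathcal{A}_X$ with $A\otimes\mathbf{1}_{S\setminus X}\in\mathcal{A}_S$. Let $D,q,R\in\mathbb{N}$ and $C_{\mathrm{int}}>0$. Then there exist $a\in(0,1)$ and $C_1,C_2,C_3>0$ such that the following holds for every finite $\Lambda\subset\mathbb{Z}^D$ and all families of self-adjoint operators $h_x\in\mathcal{A}_{\{x\}}$ and $v_x\in\mathcal{A}_{B_R(x)}$ ($x\in\mathbb{Z}^D$). Suppose that 1. for every $x$ we have $h_x\ge 0$, and there is a nonzero $\Omega_x\in\mathcal{H}_{\{x\}}$ with $\langle\Omega_x,h_x\Omega_x\rangle=0$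 and $\langle\psi,h_x\psi\rangle\ge\langle\psi,\psi\rangle$ for all $\psi\perp\Omega_x$ (a unique ground state with gap at least $1$); 2. $\|h_x\|\le C_{\mathrm{int}}$ and $\|v_x\|\le C_{\mathrm{int}}$ for every $x$; 3. for every $x$ and every $\psi\in\mathcal{H}_{B_R(x)}$, $$|\langle\psi,v_x\psi\rangle|\le\frac{a}{|B_R|}\,\Bigl|\Bigl\langle\psi,\sum_{z\in B_R(x)}h_z\,\psi\Bigr\rangle\Bigr| .$$ Let $$H_\Lambda=\sum_{x\in\Lambda}h_x+\sum_{x\in\Lambda:\,B_R(x)\subset\Lambda}v_x ,\qquad \rho_\Lambda=\frac{e^{-\beta H_\Lambda}}{\operatorname{Tr}e^{-\beta H_\Lambda}} .$$ Then for every $\beta\in(0,\infty)$, all $X,Y\subset\Lambda$, and all $A\in\mathcal{A}_X$, $B\in\mathcal{A}_Y$, $$\bigl|\operatorname{Tr}(AB\rho_\Lambda)-\operatorname{Tr}(A\rho_\Lambda)\operatorname{Tr}(B\rho_\Lambda)\bigr|\le C_1\,\|A\|\,\|B\|\,e^{C_2(|X|+|Y|)}\,e^{-C_3\operatorname{dist}(X,Y)}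 .$$ In particular $a,C_1,C_2,C_3$ do not depend on $\Lambda$ or $\beta$, so the correlation length is bounded uniformly as $T=1/\beta\to0$. -/

import Mathlib

open scoped Matrix.Norms.L2Operator ComplexOrder

namespace QuantumLattice

/-- The sites of the lattice `ℤ^D`. -/
abbrev Site (D : ℕ) : Type := Fin D → ℤ

/-- The `ℓ¹`-metric on `ℤ^D`. -/
def siteDist {D : ℕ} (x y : Site D) : ℕ := ∑ i, (x i - y i).natAbs

/-- The closed `ℓ¹`-ball of radius `r` around `x` in `ℤ^D`, cut out of a box that contains it
(see `mem_ball`). -/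
noncomputable def ball {D : ℕ} (r : ℕ) (x : Site D) : Finset (Site D) :=
  (Finset.Icc (fun i => x i - r) (fun i => x i + r)).filter fun y => siteDist x y ≤ r

theorem mem_ball {D : ℕ} (r : ℕ) (x y : Site D) : y ∈ ball r x ↔ siteDist x y ≤ r := by
  unfold ball
  simp only [Finset.mem_filter, Finset.mem_Icc, Pi.le_def, and_iff_right_iff_imp]
  intro h
  have key : ∀ i, (x i - y i).natAbs ≤ r := fun i =>
    (Finset.single_le_sum (f := fun i => (x i - y i).natAbs)
      (fun _ _ => Nat.zero_le _) (Finset.mem_univ i)).trans h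
  exact ⟨fun i => by have := key i; omega, fun i => by have := key i; omega⟩

/-- The distance of two finite sets of sites; it is `⊤` if one of them is empty. -/
noncomputable def setDist {D : ℕ} (X Y : Finset (Site D)) : ℕ∞ :=
  ⨅ x ∈ X, ⨅ y ∈ Y, (siteDist x y : ℕ∞)

/-- `expDecay c d = e^{-c d}`, with `e^{-∞} = 0`. -/
noncomputable def expDecay (c : ℝ) : ℕ∞ → ℝ
  | ⊤ => 0
  | (n : ℕ) => Real.exp (-c * n)

/-- The classical configurations on `X`; they label the product basis of `⨂_{x ∈ X} ℂ^q`. -/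
abbrev Config {D : ℕ} (q : ℕ) (X : Finset (Site D)) : Type := X → Fin q

/-- The Hilbert space `⨂_{x ∈ X} ℂ^q`, in coordinates with respect to the product basis. Inner
products are written `star φ ⬝ᵥ ψ`. -/
abbrev LocalVec {D : ℕ} (q : ℕ) (X : Finset (Site D)) : Type := Config q X → ℂ

/-- The algebra of linear operators on `⨂_{x ∈ X} ℂ^q`, as matrices in the product basis. It
carries the operator norm that comes from the Hilbert space norm. -/
abbrev LocalOp {D : ℕ} (q : ℕ) (X : Finset (Site D)) : Type :=
  Matrix (Config q X) (Config q X) ℂ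

/-- Restriction of a configuration on `S` to a subset `X`. -/
def restrictConfig {D q : ℕ} {X S : Finset (Site D)} (hXS : X ⊆ S) (σ : Config q S) :
    Config q X := fun x => σ ⟨x.1, hXS x.2⟩

/-- The identification of an operator `A` on `⨂_{x ∈ X} ℂ^q` with the operator `A ⊗ 1_{S ∖ X}`
on `⨂_{x ∈ S} ℂ^q`, for `X ⊆ S`. -/
def embed {D q : ℕ} {X S : Finset (Site D)} (hXS : X ⊆ S) (A : LocalOp q X) : LocalOp q S :=
  Matrix.of fun σ τ =>
    if ∀ z : S, z.1 ∉ X → σ z = τ z then A (restrictConfig hXS σ) (restrictConfig hXS τ) else 0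

/-- The expectation `⟨ψ, A ψ⟩`. -/
def expect {D q : ℕ} {X : Finset (Site D)} (A : LocalOp q X) (ψ : LocalVec q X) : ℂ :=
  star ψ ⬝ᵥ A.mulVec ψ

/-- `A ≥ 0` has a unique ground state, with energy `0`, separated by a gap of size at least `1`:
there is `Ω ≠ 0` with `⟨Ω, A Ω⟩ = 0` and `⟨ψ, A ψ⟩ ≥ ⟨ψ, ψ⟩` whenever `ψ ⟂ Ω`. -/
def HasUnitGap {D q : ℕ} {X : Finset (Site D)} (A : LocalOp q X) : Prop :=
  A.PosSemidef ∧ ∃ Ω : LocalVec q X, Ω ≠ 0 ∧ expect A Ω = 0 ∧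
    ∀ ψ : LocalVec q X, star Ω ⬝ᵥ ψ = 0 → (star ψ ⬝ᵥ ψ).re ≤ (expect A ψ).re

/-- The unperturbed Hamiltonian `H⁰_S = ∑_{x ∈ S} h_x`. -/
noncomputable def freeHam {D q : ℕ} (h : ∀ x : Site D, LocalOp q {x}) (S : Finset (Site D)) :
    LocalOp q S :=
  ∑ x : S, embed (Finset.singleton_subset_iff.2 x.2) (h x.1)

/-- The interaction `V_S`, the sum of `v_x` over all `x ∈ S` with `B_R(x) ⊆ S`. -/
noncomputable def interaction {D q R : ℕ} (v : ∀ x : Site D, LocalOp q (ball R x))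
    (S : Finset (Site D)) : LocalOp q S :=
  ∑ x ∈ S, if hx : ball R x ⊆ S then embed hx (v x) else 0

/-- The Hamiltonian `H_S = H⁰_S + V_S`. -/
noncomputable def ham {D q R : ℕ} (h : ∀ x : Site D, LocalOp q {x})
    (v : ∀ x : Site D, LocalOp q (ball R x)) (S : Finset (Site D)) : LocalOp q S :=
  freeHam h S + interaction v S

/-- Each `v_x` is relatively form bounded:
`|⟨ψ, v_x ψ⟩| ≤ (a / |B_R|) |⟨ψ, H⁰_{B_R(x)} ψ⟩|` for all `ψ`. -/
def RelFormBounded {D q R : ℕ} (h : ∀ x : Site D, LocalOp q {x})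
    (v : ∀ x : Site D, LocalOp q (ball R x)) (a : ℝ) : Prop :=
  ∀ (x : Site D) (ψ : LocalVec q (ball R x)),
    ‖expect (v x) ψ‖ ≤
      a / ((ball R (0 : Site D)).card : ℝ) * ‖expect (freeHam h (ball R x)) ψ‖

/-- The Gibbs state `e^{-βH} / Tr e^{-βH}`. -/
noncomputable def gibbs {D q : ℕ} {S : Finset (Site D)} (β : ℝ) (H : LocalOp q S) :
    LocalOp q S :=
  (Matrix.trace (NormedSpace.exp (-(β : ℂ) • H)))⁻¹ • NormedSpace.exp (-(β : ℂ) • H)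

/-- The covariance `Tr(ABρ) - Tr(Aρ) Tr(Bρ)`. -/
noncomputable def cov {D q : ℕ} {S : Finset (Site D)} (ρ A B : LocalOp q S) : ℂ :=
  Matrix.trace (A * B * ρ) - Matrix.trace (A * ρ) * Matrix.trace (B * ρ)

end QuantumLattice

/-!
# Decay of correlations, uniformly in the temperature

The proof makes the couplings complex: `H_S(s) = H⁰_S + ∑_x s_x v_x`. A site lies in at most `|B_R|`
balls, so the relative form bound gives `Re ⟨ψ, H_S(s) ψ⟩ ≥ 0` as long as `|s_x| ≤ a⁻¹` for all
`x` (`re_expect_coupledHam_nonneg`), and then `‖e^{-βH_S(s)}‖ ≤ 1` for every `β ≥ 0`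
(`norm_exp_le_one_of_re_nonneg`). As `h_x` has ground state energy `0`, the free partition function is
at least `1` (`one_le_norm_trace_exp_freeHam`). Hence the ratio
`relTrace s O = Tr(O e^{-βH(s)}) / Tr e^{-βH⁰}` is bounded on the polydisc by a power of `q + 1`
whose exponent is the size of the support of `O` and of the active interaction terms
(`norm_relTrace_le`), without any reference to `β`. So an expansion in space alone, with no
discretization of imaginary time, converges uniformly in `β`.

Let `Z(C)` be this ratio for `O = 1`, with couplings `1` on `C` and `0` elsewhere. Its mixed
differences in the directions `C` vanish when one of the couplings in `C` does, so Schwarz's lemma in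
each coupling bounds them by `(const · a)^{|C|}` (`norm_mixedDiff_indicator_le`). Since `Z` is
multiplicative over sets of terms whose balls do not meet, for small `a` Dobrushin's induction shows
that removing one term changes `Z` by a factor of at most `2` (`norm_erase_le`); in particular `Z`
has no zeros.

The function `relCov = relTrace(AB) relTrace(1) - relTrace(A) relTrace(B)` is the covariance times
`Z²`. It factorizes over `Z²` away from the supports of `A` and `B` (`relCov_union`), and it vanishes
when the active terms are too few to link these supports (`relCov_indicator_eq_zero`). Hence its
mixed differences carry the factor `e^{-c dist(X, Y)}`, and `norm_mixedDiff_le` sums them up, relative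
to `Z²`.
-/

namespace QuantumLattice

/-! ### Mixed differences of set functions -/

section SetFunctions

variable {ι : Type*} [DecidableEq ι]

/-- The mixed difference of a set function `Φ` in the directions `D`, based at the set `B`:
`∑_{D' ⊆ D} (-1)^{|D ∖ D'|} Φ(D' ∪ B)`. For `B = ∅` it is the Möbius transform of `Φ`. -/
noncomputable def mixedDiff (Φ : Finset ι → ℂ) (D B : Finset ι) : ℂ :=
  ∑ D' ∈ D.powerset, (-1) ^ (D \ D').card * Φ (D' ∪ B)

theorem mixedDiff_empty (Φ : Finset ι → ℂ) (B : Finset ι) : mixedDiff Φ ∅ B = Φ B := by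
  simp [mixedDiff]

theorem mixedDiff_insert (Φ : Finset ι → ℂ) {D : Finset ι} (B : Finset ι) {x : ι} (hx : x ∉ D) :
    mixedDiff Φ (insert x D) B = mixedDiff Φ D (insert x B) - mixedDiff Φ D B := by
  unfold mixedDiff
  rw [Finset.sum_powerset_insert hx, add_comm, sub_eq_add_neg, ← Finset.sum_neg_distrib]
  congr 1
  · refine Finset.sum_congr rfl fun D' hD' => ?_
    have h1 : insert x D \ insert x D' = D \ D' := by
      ext y
      simp only [Finset.mem_sdiff, Finset.mem_insert]
      grind
    rw [h1, Finset.insert_union, Finset.union_insert]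
  · refine Finset.sum_congr rfl fun D' hD' => ?_
    have h1 : insert x D \ D' = insert x (D \ D') := by
      ext y
      have := Finset.mem_powerset.1 hD'
      simp only [Finset.mem_sdiff, Finset.mem_insert]
      grind
    rw [h1, Finset.card_insert_of_notMem (by simp [hx]), pow_succ]
    ring

/-- The weights `mixedDiff Φ D ∅` control all mixed differences of `Φ`, relative to the partition
function `Z`, when `Φ` factorizes over `Z`. Here `y ∈ nb x` means that `x` and `y` interact,
and `N₀` is the set of points that interact with the observables contained in `Φ`.

The set `N` collects the points of `B` that interact with `D` or belong to `N₀`. They are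
removed from `B` one at a time: each is either dropped, or moved to `D` at the cost of a factor
`κ` and of at most `Δ` new points in `N`. When none is left, `Φ` factorizes. -/
theorem norm_mixedDiff_le (nb : ι → Finset ι) {Δ : ℕ} (hΔ : ∀ x, (nb x).card ≤ Δ)
    {Z Φ : Finset ι → ℂ} {κ M : ℝ} (hκ0 : 0 ≤ κ) (hM : 0 ≤ M) (hκ : κ * 8 ^ Δ ≤ 1)
    {N₀ : Finset ι}
    (hmul : ∀ D B : Finset ι, (∀ y ∈ B, y ∉ N₀ ∧ ∀ x ∈ D, y ∉ nb x) → Φ (D ∪ B) = Φ D * Z B)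
    (hΦ : ∀ D, ‖mixedDiff Φ D ∅‖ ≤ M * κ ^ D.card) (B : Finset ι)
    (hZ : ∀ B' ⊆ B, ∀ x ∈ B', ‖Z (B'.erase x)‖ ≤ 4 * ‖Z B'‖) (D N : Finset ι)
    (hDB : Disjoint D B) (hN : ∀ y ∈ B, y ∉ N → y ∉ N₀ ∧ ∀ x ∈ D, y ∉ nb x) :
    ‖mixedDiff Φ D B‖ ≤ M * κ ^ D.card * 8 ^ N.card * ‖Z B‖ := by
  induction hn : B.card generalizing B D N with
  | zero =>
    obtain rfl := Finset.card_eq_zero.1 hn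
    have h1 : mixedDiff Φ D ∅ = mixedDiff Φ D ∅ * Z ∅ := by
      unfold mixedDiff
      rw [Finset.sum_mul]
      refine Finset.sum_congr rfl fun D' _ => ?_
      rw [mul_assoc]
      congr 1
      simpa using hmul D' ∅ (by simp)
    rw [h1, norm_mul]
    gcongr
    refine (hΦ D).trans (le_mul_of_one_le_right (by positivity) (one_le_pow₀ (by norm_num)))
  | succ n ih =>
    by_cases hne : ∃ x ∈ B, x ∈ N
    · obtain ⟨x, hxB, hxN⟩ := hne
      have hxD : x ∉ D := fun h => Finset.disjoint_left.1 hDB h hxB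
      have hB : B = insert x (B.erase x) := (Finset.insert_erase hxB).symm
      have hcard : (B.erase x).card = n := by rw [Finset.card_erase_of_mem hxB]; omega
      have hZ' : ∀ B' ⊆ B.erase x, ∀ y ∈ B', ‖Z (B'.erase y)‖ ≤ 4 * ‖Z B'‖ :=
        fun B' hB' => hZ B' (hB'.trans (Finset.erase_subset _ _))
      have hsplit : mixedDiff Φ D B
          = mixedDiff Φ (insert x D) (B.erase x) + mixedDiff Φ D (B.erase x) := by
        rw [mixedDiff_insert Φ _ hxD, ← hB]; ring
      have h1 := ih (B.erase x) hZ' D (N.erase x)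
        (hDB.mono_right (Finset.erase_subset _ _))
        (fun y hy hyN => hN y (Finset.mem_of_mem_erase hy) fun h =>
          hyN (Finset.mem_erase.2 ⟨Finset.ne_of_mem_erase hy, h⟩)) hcard
      have h2 := ih (B.erase x) hZ' (insert x D) (N.erase x ∪ nb x)
        (by
          rw [Finset.disjoint_insert_left]
          exact ⟨Finset.notMem_erase _ _, hDB.mono_right (Finset.erase_subset _ _)⟩)
        (fun y hy hyN => by
          rw [Finset.mem_union, not_or] at hyN
          have h3 := hN y (Finset.mem_of_mem_erase hy) fun h =>
            hyN.1 (Finset.mem_erase.2 ⟨Finset.ne_of_mem_erase hy, h⟩)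
          refine ⟨h3.1, fun z hz => ?_⟩
          rcases Finset.mem_insert.1 hz with rfl | hz
          · exact hyN.2
          · exact h3.2 z hz) hcard
      have hNc : (N.erase x).card + 1 = N.card := Finset.card_erase_add_one hxN
      have h3 : (8 : ℝ) ^ (N.erase x ∪ nb x).card ≤ 8 ^ (N.erase x).card * 8 ^ Δ := by
        rw [← pow_add]
        exact pow_le_pow_right₀ (by norm_num)
          ((Finset.card_union_le _ _).trans (by have := hΔ x; omega))
      rw [Finset.card_insert_of_notMem hxD] at h2
      rw [hsplit, ← hNc]
      set c := (N.erase x).card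
      set m := D.card
      set w := ‖Z (B.erase x)‖
      have hw : w ≤ 4 * ‖Z B‖ := hZ B subset_rfl x hxB
      have hw0 : 0 ≤ w := norm_nonneg _
      calc _ ≤ M * κ ^ (m + 1) * 8 ^ (N.erase x ∪ nb x).card * w + M * κ ^ m * 8 ^ c * w :=
            (norm_add_le _ _).trans (add_le_add h2 h1)
        _ ≤ M * κ ^ (m + 1) * (8 ^ c * 8 ^ Δ) * w + M * κ ^ m * 8 ^ c * w := by gcongr
        _ = M * κ ^ m * 8 ^ c * w * (κ * 8 ^ Δ + 1) := by ring
        _ ≤ M * κ ^ m * 8 ^ c * (4 * ‖Z B‖) * (1 + 1) := by gcongr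
        _ = _ := by ring
    · push Not at hne
      have h1 : mixedDiff Φ D B = mixedDiff Φ D ∅ * Z B := by
        unfold mixedDiff
        rw [Finset.sum_mul]
        refine Finset.sum_congr rfl fun D' hD' => ?_
        rw [mul_assoc, Finset.union_empty, hmul D' B]
        intro y hy
        have h2 := hN y hy (hne y hy)
        exact ⟨h2.1, fun x hx => h2.2 x (Finset.mem_powerset.1 hD' hx)⟩
      rw [h1, norm_mul]
      gcongr
      refine (hΦ D).trans (le_mul_of_one_le_right (by positivity) (one_le_pow₀ (by norm_num)))

/-- Dobrushin's estimate: the partition function changes by a factor of at most `2` when a point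
is removed. -/
theorem norm_erase_le (nb : ι → Finset ι) {Δ : ℕ} (hΔ : ∀ x, (nb x).card ≤ Δ)
    {Z : Finset ι → ℂ} {κ : ℝ} (hκ0 : 0 ≤ κ) (hκ : κ * 8 ^ Δ ≤ 1 / 2)
    (hmul : ∀ D B : Finset ι, (∀ y ∈ B, ∀ x ∈ D, y ∉ nb x) → Z (D ∪ B) = Z D * Z B)
    (hΦ : ∀ D, ‖mixedDiff Z D ∅‖ ≤ κ ^ D.card) (B : Finset ι) :
    ∀ x ∈ B, ‖Z (B.erase x)‖ ≤ 2 * ‖Z B‖ := by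
  induction B using Finset.strongInduction with
  | H B ih =>
    intro x hx
    have hB : insert x (B.erase x) = B := Finset.insert_erase hx
    have h1 := norm_mixedDiff_le nb hΔ (Z := Z) (Φ := Z) (M := 1) (N₀ := ∅) hκ0 zero_le_one
      (hκ.trans (by norm_num)) (fun D B h => hmul D B fun y hy => (h y hy).2) (by simpa using hΦ)
      (B.erase x)
      (fun B' hB' y hy => (ih B' (hB'.trans_ssubset (Finset.erase_ssubset hx)) y hy).trans
        (by gcongr; norm_num))
      {x} (nb x) (by simp) (by simp)
    have h2 := mixedDiff_insert Z (D := ∅) (B.erase x) (x := x) (by simp)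
    rw [hB, mixedDiff_empty, mixedDiff_empty] at h2
    rw [insert_empty_eq] at h2
    rw [h2] at h1
    have h3 : (8 : ℝ) ^ (nb x).card ≤ 8 ^ Δ := pow_le_pow_right₀ (by norm_num) (hΔ x)
    have h4 : ‖Z B - Z (B.erase x)‖ ≤ 1 / 2 * ‖Z (B.erase x)‖ := by
      refine h1.trans ?_
      gcongr
      simp only [Finset.card_singleton, pow_one, one_mul]
      exact (mul_le_mul_of_nonneg_left h3 hκ0).trans hκ
    have h5 := norm_sub_norm_le (Z (B.erase x)) (Z B)
    rw [norm_sub_rev] at h5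
    linarith

/-- A function on a polydisc that vanishes on the coordinate hyperplanes with directions in `D`
is of order `∏_{x ∈ D} |s x|`: Schwarz's lemma, one coordinate at a time. -/
theorem norm_le_of_vanishing {f : (ι → ℂ) → ℂ} {M r : ℝ} (hr : 1 < r) (D : Finset ι)
    (hdiff : ∀ s : ι → ℂ, ∀ x ∈ D, Differentiable ℂ fun ζ => f (Function.update s x ζ))
    (hbound : ∀ s : ι → ℂ, (∀ y, ‖s y‖ ≤ r) → ‖f s‖ ≤ M)
    (hvan : ∀ s : ι → ℂ, ∀ x ∈ D, s x = 0 → f s = 0) (s : ι → ℂ) (hs : ∀ y, ‖s y‖ ≤ r)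
    (hs1 : ∀ y ∈ D, ‖s y‖ ≤ 1) : ‖f s‖ ≤ M * r⁻¹ ^ D.card := by
  have key : ∀ E ⊆ D, ∀ s : ι → ℂ, (∀ y, ‖s y‖ ≤ r) → (∀ y ∈ E, ‖s y‖ ≤ 1) →
      ‖f s‖ ≤ M * r⁻¹ ^ E.card := by
    intro E
    induction E using Finset.induction_on with
    | empty => intro _ s hs _; simpa using hbound s hs
    | insert x E hxE ih =>
      intro hED s hs hs1
      have hxD : x ∈ D := hED (Finset.mem_insert_self _ _)
      have hr0 : 0 < r := one_pos.trans hr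
      set g : ℂ → ℂ := fun ζ => f (Function.update s x ζ) with hg
      have hg0 : g 0 = 0 := hvan _ x hxD (by simp)
      have hmaps : Set.MapsTo g (Metric.ball 0 r) (Metric.closedBall (g 0) (M * r⁻¹ ^ E.card)) := by
        intro ζ hζ
        rw [hg0, mem_closedBall_zero_iff]
        refine ih ((Finset.subset_insert _ _).trans hED) _ (fun y => ?_) fun y hy => ?_
        · by_cases hyx : y = x
          · subst hyx; simpa using (mem_ball_zero_iff.1 hζ).le
          · simpa [hyx] using hs y
        · have hyx : y ≠ x := fun h => hxE (h ▸ hy)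
          simpa [hyx] using hs1 y (Finset.mem_insert_of_mem hy)
      have hsx : ‖s x‖ ≤ 1 := hs1 x (Finset.mem_insert_self _ _)
      have h1 := Complex.dist_le_div_mul_dist_of_mapsTo_ball (hdiff s x hxD).differentiableOn hmaps
        (mem_ball_zero_iff.2 (hsx.trans_lt hr))
      have hgx : g (s x) = f s := by simp [hg]
      change dist (g (s x)) (g 0) ≤ _ at h1
      rw [hgx, hg0, dist_zero_right, dist_zero_right] at h1
      have hM : 0 ≤ M := (norm_nonneg _).trans (hbound s hs)
      rw [Finset.card_insert_of_notMem hxE, pow_succ, ← mul_assoc]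
      refine h1.trans ?_
      rw [div_eq_mul_inv]
      exact mul_le_of_le_one_right (by positivity) hsx
  exact key D subset_rfl s hs hs1

/-- If `Φ` ignores a point of `D`, its mixed difference in the directions `D` vanishes. -/
theorem mixedDiff_eq_zero {Φ : Finset ι → ℂ} {D : Finset ι} {x : ι} (hx : x ∈ D)
    (h : ∀ C, Φ (insert x C) = Φ C) : mixedDiff Φ D ∅ = 0 := by
  rw [← Finset.insert_erase hx, mixedDiff_insert _ _ (Finset.notMem_erase _ _)]
  unfold mixedDiff
  rw [sub_eq_zero]
  refine Finset.sum_congr rfl fun D' _ => ?_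
  rw [Finset.union_insert, Finset.union_empty, h]

theorem norm_mixedDiff_le_of_forall {Φ : Finset ι → ℂ} {D : Finset ι} {M : ℝ}
    (h : ∀ C ⊆ D, ‖Φ C‖ ≤ M) : ‖mixedDiff Φ D ∅‖ ≤ 2 ^ D.card * M := by
  unfold mixedDiff
  refine (norm_sum_le_of_le (D.powerset) (f := fun D' => (-1) ^ (D \ D').card * Φ (D' ∪ ∅))
    (n := fun _ => M) fun D' hD' => ?_).trans ?_
  · simpa using h D' (Finset.mem_powerset.1 hD')
  · simp [Finset.card_powerset]

/-- A function `G` of the couplings that is bounded on a polydisc of radius `r`, by a bound that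
is exponential in the number of active couplings, has mixed differences of order `r^{-|D|}`. -/
theorem norm_mixedDiff_indicator_le {G : (ι → ℂ) → ℂ} {M c r : ℝ} (hr : 1 < r)
    (D : Finset ι)
    (hdiff : ∀ s : ι → ℂ, ∀ x, Differentiable ℂ fun ζ => G (Function.update s x ζ))
    (hbound : ∀ s : ι → ℂ, (∀ y, ‖s y‖ ≤ r) → ∀ C ⊆ D, (∀ y ∉ C, s y = 0) →
      ‖G s‖ ≤ M * c ^ D.card) :
    ‖mixedDiff (fun C => G ((C : Set ι).indicator 1)) D ∅‖ ≤ M * (2 * c * r⁻¹) ^ D.card := by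
  classical
  set f : (ι → ℂ) → ℂ := fun s => mixedDiff (fun C => G ((C : Set ι).indicator s)) D ∅ with hf
  have h := norm_le_of_vanishing (f := f) (M := 2 ^ D.card * (M * c ^ D.card)) hr D ?_ ?_ ?_ 1
    (by intro y; simpa using hr.le) (by intro y _; simp)
  · refine h.trans (le_of_eq ?_)
    rw [mul_pow, mul_pow]; ring
  · intro s x _
    simp only [hf, mixedDiff]
    refine Differentiable.fun_sum fun C _ => Differentiable.const_mul ?_ _
    by_cases hx : x ∈ ((C ∪ ∅ : Finset ι) : Set ι)
    · have : ∀ ζ, (((C ∪ ∅ : Finset ι) : Set ι).indicator (Function.update s x ζ))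
          = Function.update (((C ∪ ∅ : Finset ι) : Set ι).indicator s) x ζ := by
        intro ζ; ext y
        by_cases hy : y = x
        · subst hy; rw [Set.indicator_of_mem hx]; simp
        · simp [Set.indicator, hy]
      simp only [this]
      exact hdiff _ x
    · have : ∀ ζ, (((C ∪ ∅ : Finset ι) : Set ι).indicator (Function.update s x ζ))
          = (((C ∪ ∅ : Finset ι) : Set ι).indicator s) := by
        intro ζ; ext y
        by_cases hy : y = x
        · subst hy; rw [Set.indicator_of_notMem hx, Set.indicator_of_notMem hx]
        · simp [Set.indicator, hy]
      simp only [this]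
      exact differentiable_const _
  · intro s hs
    refine norm_mixedDiff_le_of_forall fun C hC => hbound _ (fun y => ?_) C hC fun y hy => ?_
    · by_cases hy : y ∈ (C : Set ι)
      · simpa [Set.indicator_of_mem hy] using hs y
      · simpa [Set.indicator_of_notMem hy] using (zero_le_one.trans hr.le)
    · exact Set.indicator_of_notMem (by simpa using hy) _
  · intro s x hx hsx
    refine mixedDiff_eq_zero hx fun C => ?_
    congr 1
    ext y
    by_cases hy : y = x
    · subst hy; simp [Set.indicator, hsx]
    · simp [Set.indicator, hy]

end SetFunctions

/-! ### The embedding of local operators -/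

section Embedding

open scoped Kronecker

variable {D q : ℕ} {X Y S : Finset (Site D)}

/-- Splitting a configuration on `S` into its restrictions to `X ⊆ S` and to `S ∖ X`. -/
def splitConfig (q : ℕ) (hXS : X ⊆ S) : Config q S ≃ Config q X × Config q (S \ X) where
  toFun σ := (restrictConfig hXS σ, restrictConfig Finset.sdiff_subset σ)
  invFun p z := if hz : z.1 ∈ X then p.1 ⟨z, hz⟩ else p.2 ⟨z, Finset.mem_sdiff.2 ⟨z.2, hz⟩⟩
  left_inv σ := by
    ext z
    by_cases hz : z.1 ∈ X <;> simp [restrictConfig, hz]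
  right_inv p := by
    refine Prod.ext ?_ ?_
    · ext z
      simp [restrictConfig]
    · ext z
      simp [restrictConfig, (Finset.mem_sdiff.1 z.2).2]

theorem embed_eq_kronecker (hXS : X ⊆ S) (A : LocalOp q X) :
    embed hXS A = (A ⊗ₖ (1 : LocalOp q (S \ X))).submatrix (splitConfig q hXS)
      (splitConfig q hXS) := by
  ext σ τ
  have h : (∀ z : S, z.1 ∉ X → σ z = τ z) ↔
      restrictConfig (Finset.sdiff_subset : S \ X ⊆ S) σ = restrictConfig Finset.sdiff_subset τ := by
    constructor
    · intro h
      ext z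
      rw [restrictConfig, h _ (Finset.mem_sdiff.1 z.2).2]
      rfl
    · intro h z hz
      exact congrFun h ⟨z, Finset.mem_sdiff.2 ⟨z.2, hz⟩⟩
  simp only [embed, Matrix.of_apply, h, Matrix.submatrix_apply, Matrix.kroneckerMap_apply,
    Matrix.one_apply, splitConfig, Equiv.coe_fn_mk, mul_ite, mul_one, mul_zero]

theorem embed_sdiff_eq_kronecker (hXS : X ⊆ S) (B : LocalOp q (S \ X)) :
    embed Finset.sdiff_subset B = ((1 : LocalOp q X) ⊗ₖ B).submatrix (splitConfig q hXS)
      (splitConfig q hXS) := by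
  ext σ τ
  have h : (∀ z : S, z.1 ∉ S \ X → σ z = τ z) ↔
      restrictConfig hXS σ = restrictConfig hXS τ := by
    constructor
    · intro h
      ext z
      rw [restrictConfig, h _ (by simp [z.2])]
      rfl
    · intro h z hz
      have hzX : z.1 ∈ X := by
        by_contra hn
        exact hz (Finset.mem_sdiff.2 ⟨z.2, hn⟩)
      exact congrFun h ⟨z, hzX⟩
  simp only [embed, Matrix.of_apply, h, Matrix.submatrix_apply, Matrix.kroneckerMap_apply,
    Matrix.one_apply, splitConfig, Equiv.coe_fn_mk, ite_mul, one_mul, zero_mul]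

/-- The embedding of local operators as a homomorphism of `*`-algebras. -/
noncomputable def embedHom (q : ℕ) (hXS : X ⊆ S) : LocalOp q X →⋆ₐ[ℂ] LocalOp q S where
  toFun := embed hXS
  map_one' := by rw [embed_eq_kronecker]; simp
  map_mul' A B := by
    simp only [embed_eq_kronecker]
    rw [Matrix.submatrix_mul_equiv, ← Matrix.mul_kronecker_mul, mul_one]
  map_zero' := by rw [embed_eq_kronecker]; simp
  map_add' A B := by
    simp only [embed_eq_kronecker]
    rw [Matrix.add_kronecker]; rfl
  commutes' c := by
    rw [Algebra.algebraMap_eq_smul_one, Algebra.algebraMap_eq_smul_one, embed_eq_kronecker,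
      Matrix.smul_kronecker, Matrix.submatrix_smul]
    simp
  map_star' A := by
    simp only [embed_eq_kronecker, Matrix.star_eq_conjTranspose]
    rw [Matrix.conjTranspose_submatrix, Matrix.conjTranspose_kronecker, Matrix.conjTranspose_one]

theorem embedHom_apply (hXS : X ⊆ S) (A : LocalOp q X) : embedHom q hXS A = embed hXS A := rfl

theorem embed_embed (hXY : X ⊆ Y) (hYS : Y ⊆ S) (A : LocalOp q X) :
    embed hYS (embed hXY A) = embed (hXY.trans hYS) A := by
  ext σ τ
  simp only [embed, Matrix.of_apply]
  by_cases h : ∀ z : S, z.1 ∉ X → σ z = τ z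
  · have h1 : ∀ z : S, z.1 ∉ Y → σ z = τ z := fun z hz => h z fun hzX => hz (hXY hzX)
    have h2 : ∀ z : Y, z.1 ∉ X → restrictConfig hYS σ z = restrictConfig hYS τ z :=
      fun z hz => h ⟨z.1, hYS z.2⟩ hz
    rw [if_pos h, if_pos h1, if_pos h2]
    rfl
  · rw [if_neg h]
    by_cases h1 : ∀ z : S, z.1 ∉ Y → σ z = τ z
    · rw [if_pos h1, if_neg]
      intro h2
      refine h fun z hz => ?_
      by_cases hzY : z.1 ∈ Y
      · exact h2 ⟨z.1, hzY⟩ hz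
      · exact h1 z hzY
    · rw [if_neg h1]

theorem embed_self (h : S ⊆ S) (A : LocalOp q S) : embed h A = A := by
  ext σ τ
  simp only [embed, Matrix.of_apply]
  rw [if_pos fun z hz => absurd z.2 hz]
  rfl

theorem embed_one (hXS : X ⊆ S) : embed hXS (1 : LocalOp q X) = 1 := map_one (embedHom q hXS)

theorem embed_mul (hXS : X ⊆ S) (A B : LocalOp q X) :
    embed hXS (A * B) = embed hXS A * embed hXS B := map_mul (embedHom q hXS) A B

theorem embed_add (hXS : X ⊆ S) (A B : LocalOp q X) :
    embed hXS (A + B) = embed hXS A + embed hXS B := map_add (embedHom q hXS) A B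

theorem embed_smul (hXS : X ⊆ S) (c : ℂ) (A : LocalOp q X) :
    embed hXS (c • A) = c • embed hXS A := map_smul (embedHom q hXS) c A

theorem norm_embed_le (hXS : X ⊆ S) (A : LocalOp q X) : ‖embed hXS A‖ ≤ ‖A‖ :=
  NonUnitalStarAlgHom.norm_apply_le (embedHom q hXS) A

theorem embed_exp (hXS : X ⊆ S) (A : LocalOp q X) :
    embed hXS (NormedSpace.exp A) = NormedSpace.exp (embed hXS A) :=
  let _ : NormedAlgebra ℚ (LocalOp q X) := NormedAlgebra.restrictScalars ℚ ℂ _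
  NormedSpace.map_exp (embedHom q hXS)
    (LinearMap.continuous_of_finiteDimensional (embedHom q hXS).toAlgHom.toLinearMap) A

theorem posSemidef_embed (hXS : X ⊆ S) {A : LocalOp q X} (hA : A.PosSemidef) :
    (embed hXS A).PosSemidef := by
  rw [embed_eq_kronecker]
  exact (hA.kronecker Matrix.PosSemidef.one).submatrix _

theorem commute_embed_sdiff (hXS : X ⊆ S) (A : LocalOp q X) (B : LocalOp q (S \ X)) :
    Commute (embed hXS A) (embed Finset.sdiff_subset B) := by
  rw [commute_iff_eq, embed_eq_kronecker, embed_sdiff_eq_kronecker hXS,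
    Matrix.submatrix_mul_equiv, Matrix.submatrix_mul_equiv, ← Matrix.mul_kronecker_mul,
    ← Matrix.mul_kronecker_mul]
  simp

theorem trace_embed_mul_embed_sdiff (hXS : X ⊆ S) (A : LocalOp q X) (B : LocalOp q (S \ X)) :
    (embed hXS A * embed Finset.sdiff_subset B).trace = A.trace * B.trace := by
  rw [embed_eq_kronecker, embed_sdiff_eq_kronecker hXS, Matrix.submatrix_mul_equiv,
    ← Matrix.mul_kronecker_mul, mul_one, one_mul, ← Matrix.trace_kronecker]
  exact Fintype.sum_equiv (splitConfig q hXS) _ _ fun _ => rfl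

end Embedding

/-! ### Matrix exponentials -/

section Exponential

open Matrix

/-- The semigroup generated by a dissipative operator is contractive: the derivative of
`‖e^{-tK} v‖²` is nonpositive. -/
theorem norm_exp_le_one_of_re_inner_nonneg {E : Type*} [NormedAddCommGroup E]
    [InnerProductSpace ℂ E] [CompleteSpace E] (K : E →L[ℂ] E)
    (hK : ∀ x, 0 ≤ (inner ℂ x (K x)).re) {β : ℝ} (hβ : 0 ≤ β) :
    ‖NormedSpace.exp (-(β : ℂ) • K)‖ ≤ 1 := by
  refine ContinuousLinearMap.opNorm_le_bound _ zero_le_one fun v => ?_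
  let _ : InnerProductSpace ℝ E := InnerProductSpace.rclikeToReal ℂ E
  set u : ℝ → E := fun t => NormedSpace.exp (t • (-K)) v with hu
  have hder : ∀ t, HasDerivAt u (-(K (u t))) t := by
    intro t
    have h1 := hasDerivAt_exp_smul_const' (𝕂 := ℝ) (-K) t
    have h2 := ((ContinuousLinearMap.apply ℂ E v).restrictScalars ℝ).hasFDerivAt.comp_hasDerivAt
      t h1
    exact h2.congr_deriv rfl
  have hanti : Antitone fun t => ‖u t‖ ^ 2 := by
    refine antitone_of_hasDerivAt_nonpos (fun t => (hder t).norm_sq) fun t => ?_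
    rw [inner_neg_right]
    have := hK (u t)
    have h3 : inner ℝ (u t) (K (u t)) = (inner ℂ (u t) (K (u t))).re := rfl
    simp only [Pi.zero_apply]
    linarith
  have h4 := hanti hβ
  have h5 : NormedSpace.exp (-(β : ℂ) • K) v = u β := by
    simp only [hu]
    congr 2
    rw [smul_neg, neg_smul]
    rfl
  have h6 : u 0 = v := by simp [hu]
  rw [h5, one_mul]
  simp only [h6] at h4
  exact (pow_le_pow_iff_left₀ (norm_nonneg _) (norm_nonneg _) two_ne_zero).1 h4

variable {n : Type*} [Fintype n] [DecidableEq n]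

theorem norm_exp_le_one_of_re_nonneg (H : Matrix n n ℂ)
    (hH : ∀ ψ : n → ℂ, 0 ≤ (star ψ ⬝ᵥ H *ᵥ ψ).re) {β : ℝ} (hβ : 0 ≤ β) :
    ‖NormedSpace.exp (-(β : ℂ) • H)‖ ≤ 1 := by
  let _ : NormedAlgebra ℚ (Matrix n n ℂ) := NormedAlgebra.restrictScalars ℚ ℂ _
  rw [Matrix.cstar_norm_def, NormedSpace.map_exp (toEuclideanCLM (n := n) (𝕜 := ℂ))
    (LinearMap.continuous_of_finiteDimensional
      (toEuclideanCLM (n := n) (𝕜 := ℂ)).toAlgEquiv.toLinearMap), map_smul]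
  refine norm_exp_le_one_of_re_inner_nonneg _ (fun x => ?_) hβ
  have h := hH x.ofLp
  rw [EuclideanSpace.inner_eq_star_dotProduct, Matrix.ofLp_toEuclideanCLM, dotProduct_comm]
  exact h

theorem norm_apply_le_l2OpNorm (M : Matrix n n ℂ) (i : n) : ‖M i i‖ ≤ ‖M‖ := by
  have h := Matrix.l2_opNorm_mulVec M (EuclideanSpace.single i 1)
  rw [PiLp.norm_single, norm_one, mul_one] at h
  refine le_trans ?_ h
  have h2 := PiLp.norm_apply_le ((EuclideanSpace.equiv n ℂ).symm
    (M *ᵥ (EuclideanSpace.single i (1 : ℂ)).ofLp)) i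
  refine le_trans (le_of_eq ?_) h2
  simp

theorem norm_trace_le (M : Matrix n n ℂ) : ‖M.trace‖ ≤ Fintype.card n * ‖M‖ := by
  refine (norm_sum_le_of_le _ fun i _ => norm_apply_le_l2OpNorm M i).trans ?_
  simp

/-- The partition function of a system with ground state energy `0` is at least `1`. -/
theorem one_le_norm_trace_exp {h : Matrix n n ℂ} (hh : h.IsHermitian) {Ω : n → ℂ} (hΩ : Ω ≠ 0)
    (hΩ0 : h *ᵥ Ω = 0) (β : ℝ) : 1 ≤ ‖(NormedSpace.exp (-(β : ℂ) • h)).trace‖ := by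
  let _ : NormedAlgebra ℚ (Matrix n n ℂ) := NormedAlgebra.restrictScalars ℚ ℂ _
  set M := NormedSpace.exp (-(β : ℂ) • h) with hM
  have hpos : M.PosSemidef := by
    set c : ℂ := -((β / 2 : ℝ) : ℂ) with hc
    have hA : (c • h).IsHermitian := by
      rw [Matrix.IsHermitian, Matrix.conjTranspose_smul, hh.eq]
      simp [hc]
    have h1 : M = (NormedSpace.exp (c • h))ᴴ * NormedSpace.exp (c • h) := by
      rw [hA.exp.eq, ← NormedSpace.exp_add_of_commute (Commute.refl _), ← add_smul, hM]
      congr 2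
      rw [hc]; push_cast; ring
    rw [h1]
    exact Matrix.posSemidef_conjTranspose_mul_self _
  have hspec : (1 : ℝ) ∈ spectrum ℝ M := by
    have h0 : (0 : ℂ) ∈ spectrum ℂ (-(β : ℂ) • h) := by
      rw [spectrum.zero_mem_iff, Matrix.isUnit_iff_isUnit_det, isUnit_iff_ne_zero, not_not]
      exact Matrix.exists_mulVec_eq_zero_iff.1 ⟨Ω, hΩ, by rw [smul_mulVec, hΩ0, smul_zero]⟩
    have h1 := spectrum.exp_mem_exp (-(β : ℂ) • h) h0
    rw [NormedSpace.exp_zero] at h1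
    have h2 : algebraMap ℝ ℂ 1 ∈ spectrum ℂ M := by rw [map_one]; exact h1
    exact (spectrum.algebraMap_mem_iff ℂ).1 h2
  rw [hpos.1.spectrum_real_eq_range_eigenvalues] at hspec
  obtain ⟨i, hi⟩ := hspec
  rw [hpos.1.trace_eq_sum_eigenvalues, ← RCLike.ofReal_sum]
  refine le_trans ?_ (le_abs_self _ |>.trans_eq (RCLike.norm_ofReal _).symm)
  rw [← hi]
  exact Finset.single_le_sum (fun j _ => hpos.eigenvalues_nonneg j) (Finset.mem_univ i)

end Exponential

/-! ### Geometry of the lattice -/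

section Geometry

variable {D : ℕ}

theorem siteDist_comm (x y : Site D) : siteDist x y = siteDist y x :=
  Finset.sum_congr rfl fun i _ => by omega

theorem siteDist_triangle (x y z : Site D) : siteDist x z ≤ siteDist x y + siteDist y z := by
  unfold siteDist
  rw [← Finset.sum_add_distrib]
  exact Finset.sum_le_sum fun i _ => by omega

theorem siteDist_self (x : Site D) : siteDist x x = 0 := by simp [siteDist]

theorem mem_ball_self (R : ℕ) (x : Site D) : x ∈ ball R x := by simp [mem_ball, siteDist_self]

theorem mem_ball_comm {R : ℕ} {x y : Site D} : y ∈ ball R x ↔ x ∈ ball R y := by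
  rw [mem_ball, mem_ball, siteDist_comm]

theorem card_ball (R : ℕ) (x : Site D) : (ball R x).card = (ball R (0 : Site D)).card := by
  have h : ball R x = (ball R (0 : Site D)).map (addRightEmbedding x) := by
    ext y
    simp only [Finset.mem_map, addRightEmbedding_apply, mem_ball]
    constructor
    · intro hy
      refine ⟨y - x, ?_, by simp⟩
      refine le_of_eq_of_le (Finset.sum_congr rfl fun i _ => ?_) hy
      simp
    · rintro ⟨w, hw, rfl⟩
      simpa [siteDist] using hw
  rw [h, Finset.card_map]

theorem card_ball_pos (D R : ℕ) : 0 < (ball R (0 : Site D)).card :=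
  Finset.card_pos.2 ⟨0, mem_ball_self R 0⟩

end Geometry

/-! ### Hamiltonians with variable couplings -/

section Hamiltonian

open Matrix

variable {D q R : ℕ} {X S : Finset (Site D)}

/-- The Hamiltonian `H⁰_S + ∑_x s_x v_x` with complex couplings `s_x`. -/
noncomputable def coupledHam (h : ∀ x : Site D, LocalOp q {x})
    (v : ∀ x : Site D, LocalOp q (ball R x)) (s : Site D → ℂ) (S : Finset (Site D)) :
    LocalOp q S :=
  freeHam h S + ∑ x ∈ S, if hx : ball R x ⊆ S then s x • embed hx (v x) else 0

variable {h : ∀ x : Site D, LocalOp q {x}} {v : ∀ x : Site D, LocalOp q (ball R x)}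

theorem coupledHam_one : coupledHam h v 1 S = ham h v S := by
  simp [coupledHam, ham, interaction]

theorem coupledHam_congr {s t : Site D → ℂ} (hst : ∀ x, ball R x ⊆ S → s x = t x) :
    coupledHam h v s S = coupledHam h v t S := by
  unfold coupledHam
  congr 1
  refine Finset.sum_congr rfl fun x _ => ?_
  split_ifs with hx
  · rw [hst x hx]
  · rfl

theorem coupledHam_eq_freeHam {s : Site D → ℂ} (hs : ∀ x, ball R x ⊆ S → s x = 0) :
    coupledHam h v s S = freeHam h S := by
  rw [coupledHam, add_eq_left]
  refine Finset.sum_eq_zero fun x _ => ?_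
  split_ifs with hx
  · rw [hs x hx, zero_smul]
  · rfl

/-- The one-site term `h_x` as an operator on `S`; zero if `x ∉ S`. -/
noncomputable def siteTerm (h : ∀ x : Site D, LocalOp q {x}) (S : Finset (Site D)) (x : Site D) :
    LocalOp q S :=
  if hx : {x} ⊆ S then embed hx (h x) else 0

theorem embed_freeHam (hXS : X ⊆ S) : embed hXS (freeHam h X) = ∑ x ∈ X, siteTerm h S x := by
  rw [← embedHom_apply, freeHam, map_sum, ← Finset.sum_coe_sort X]
  refine Finset.sum_congr rfl fun x _ => ?_
  have hx : {x.1} ⊆ S := Finset.singleton_subset_iff.2 (hXS x.2)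
  rw [embedHom_apply, embed_embed, siteTerm, dif_pos hx]

theorem freeHam_eq_sum : freeHam h S = ∑ x ∈ S, siteTerm h S x := by
  rw [← embed_freeHam subset_rfl, embed_self]

theorem embed_coupledHam (hXS : X ⊆ S) (s : Site D → ℂ) :
    embed hXS (coupledHam h v s X) = ∑ x ∈ X, siteTerm h S x +
      ∑ x ∈ X, if hx : ball R x ⊆ X then s x • embed (hx.trans hXS) (v x) else 0 := by
  rw [coupledHam, embed_add, embed_freeHam, ← embedHom_apply, map_sum]
  congr 1
  refine Finset.sum_congr rfl fun x _ => ?_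
  split_ifs with hx
  · rw [embedHom_apply, embed_smul, embed_embed]
  · exact map_zero _

/-- If no active interaction term couples `X` to `S ∖ X`, the Hamiltonian is a sum. -/
theorem coupledHam_split (hXS : X ⊆ S) {s : Site D → ℂ}
    (hs : ∀ x, s x ≠ 0 → ball R x ⊆ S → ball R x ⊆ X ∨ ball R x ⊆ S \ X) :
    coupledHam h v s S = embed hXS (coupledHam h v s X) +
      embed Finset.sdiff_subset (coupledHam h v s (S \ X)) := by
  rw [embed_coupledHam, embed_coupledHam, coupledHam, freeHam_eq_sum,
    ← Finset.sum_sdiff hXS (f := siteTerm h S), ← Finset.sum_sdiff hXS (f := fun x =>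
      if hx : ball R x ⊆ S then s x • embed hx (v x) else 0)]
  have h1 : ∑ x ∈ X, (if hx : ball R x ⊆ S then s x • embed hx (v x) else 0)
      = ∑ x ∈ X, if hx : ball R x ⊆ X then s x • embed (hx.trans hXS) (v x) else 0 := by
    refine Finset.sum_congr rfl fun x hxX => ?_
    by_cases hx : ball R x ⊆ X
    · rw [dif_pos hx, dif_pos (hx.trans hXS)]
    · rw [dif_neg hx]
      split_ifs with hxS
      · by_cases h0 : s x = 0
        · rw [h0, zero_smul]
        · rcases hs x h0 hxS with h2 | h2
          · exact absurd h2 hx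
          · exact absurd hxX (Finset.mem_sdiff.1 (h2 (mem_ball_self R x))).2
      · rfl
  have h2 : ∑ x ∈ S \ X, (if hx : ball R x ⊆ S then s x • embed hx (v x) else 0)
      = ∑ x ∈ S \ X, if hx : ball R x ⊆ S \ X then
          s x • embed (hx.trans Finset.sdiff_subset) (v x) else 0 := by
    refine Finset.sum_congr rfl fun x hxX => ?_
    by_cases hx : ball R x ⊆ S \ X
    · rw [dif_pos hx, dif_pos (hx.trans Finset.sdiff_subset)]
    · rw [dif_neg hx]
      split_ifs with hxS
      · by_cases h0 : s x = 0
        · rw [h0, zero_smul]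
        · rcases hs x h0 hxS with h2 | h2
          · exact absurd (h2 (mem_ball_self R x)) (Finset.mem_sdiff.1 hxX).2
          · exact absurd h2 hx
      · rfl
  rw [h1, h2]
  abel

theorem expect_add (A B : LocalOp q S) (ψ : LocalVec q S) :
    expect (A + B) ψ = expect A ψ + expect B ψ := by
  simp [expect, add_mulVec, dotProduct_add]

theorem expect_neg (A : LocalOp q S) (ψ : LocalVec q S) : expect (-A) ψ = -expect A ψ := by
  simp [expect, neg_mulVec]

theorem expect_smul (c : ℂ) (A : LocalOp q S) (ψ : LocalVec q S) :
    expect (c • A) ψ = c * expect A ψ := by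
  simp [expect, smul_mulVec]

theorem expect_sum {ι : Type*} (I : Finset ι) (A : ι → LocalOp q S) (ψ : LocalVec q S) :
    expect (∑ i ∈ I, A i) ψ = ∑ i ∈ I, expect (A i) ψ := by
  simp [expect, sum_mulVec, dotProduct_sum]

theorem expect_nonneg {A : LocalOp q S} (hA : A.PosSemidef) (ψ : LocalVec q S) :
    0 ≤ expect A ψ := hA.dotProduct_mulVec_nonneg ψ

theorem expect_im_eq_zero {A : LocalOp q S} (hA : A.IsHermitian) (ψ : LocalVec q S) :
    (expect A ψ).im = 0 := hA.im_star_dotProduct_mulVec_self ψ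

theorem posSemidef_siteTerm (hh : ∀ x, (h x).PosSemidef) (S : Finset (Site D)) (x : Site D) :
    (siteTerm h S x).PosSemidef := by
  unfold siteTerm
  split_ifs with hx
  · exact posSemidef_embed hx (hh x)
  · exact PosSemidef.zero

theorem posSemidef_freeHam (hh : ∀ x, (h x).PosSemidef) (S : Finset (Site D)) :
    (freeHam h S).PosSemidef := by
  rw [freeHam_eq_sum]
  exact Matrix.posSemidef_sum _ fun x _ => posSemidef_siteTerm hh S x

/-- The relative form bound passes from `B_R(x)` to any larger set. It says that
`c H⁰_{B_R(x)} ± v_x` are positive, and positivity is preserved by the embedding. -/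
theorem norm_expect_embed_le (hh : ∀ x, (h x).PosSemidef) (hv : ∀ x, (v x).IsHermitian) {a : ℝ}
    (hrel : RelFormBounded h v a) {x : Site D} (hx : ball R x ⊆ S) (ψ : LocalVec q S) :
    ‖expect (embed hx (v x)) ψ‖ ≤
      a / (ball R (0 : Site D)).card * ∑ z ∈ ball R x, (expect (siteTerm h S z) ψ).re := by
  set c : ℝ := a / (ball R (0 : Site D)).card
  have hK := posSemidef_freeHam hh (ball R x)
  have hsum : expect (embed hx (freeHam h (ball R x))) ψ
      = ∑ z ∈ ball R x, expect (siteTerm h S z) ψ := by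
    rw [embed_freeHam, expect_sum]
  have hcK : ((c : ℂ) • freeHam h (ball R x)).IsHermitian := by
    rw [IsHermitian, conjTranspose_smul, hK.1.eq]
    simp
  have hbd : ∀ φ, |(expect (v x) φ).re| ≤ c * (expect (freeHam h (ball R x)) φ).re := by
    intro φ
    have h1 := hrel x φ
    rw [← Complex.re_eq_norm.2 (expect_nonneg hK φ)] at h1
    exact (Complex.abs_re_le_norm _).trans h1
  have hplus : ((c : ℂ) • freeHam h (ball R x) + v x).PosSemidef := by
    refine PosSemidef.of_dotProduct_mulVec_nonneg (hcK.add (hv x)) fun φ => ?_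
    change 0 ≤ expect _ φ
    refine Complex.nonneg_iff.2 ⟨?_, (expect_im_eq_zero (hcK.add (hv x)) φ).symm⟩
    rw [expect_add, expect_smul, Complex.add_re, Complex.re_ofReal_mul]
    have := (abs_le.1 (hbd φ)).1
    linarith
  have hminus : ((c : ℂ) • freeHam h (ball R x) + -v x).PosSemidef := by
    refine PosSemidef.of_dotProduct_mulVec_nonneg (hcK.add (hv x).neg) fun φ => ?_
    change 0 ≤ expect _ φ
    refine Complex.nonneg_iff.2 ⟨?_, (expect_im_eq_zero (hcK.add (hv x).neg) φ).symm⟩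
    rw [expect_add, expect_smul, expect_neg, Complex.add_re, Complex.re_ofReal_mul,
      Complex.neg_re]
    have := (abs_le.1 (hbd φ)).2
    linarith
  have h1 := (Complex.nonneg_iff.1 (expect_nonneg (posSemidef_embed hx hplus) ψ)).1
  have h2 := (Complex.nonneg_iff.1 (expect_nonneg (posSemidef_embed hx hminus) ψ)).1
  have hneg : embed hx (-v x) = -embed hx (v x) := map_neg (embedHom q hx) (v x)
  rw [embed_add, embed_smul, expect_add, expect_smul, hsum, Complex.add_re,
    Complex.re_ofReal_mul, Complex.re_sum] at h1
  rw [embed_add, embed_smul, expect_add, expect_smul, hsum, hneg, expect_neg, Complex.add_re,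
    Complex.re_ofReal_mul, Complex.re_sum, Complex.neg_re] at h2
  have hherm : (embed hx (v x)).IsHermitian := by
    have := map_star (embedHom q hx) (v x)
    rw [star_eq_conjTranspose, (hv x).eq] at this
    exact this.symm
  have h3 : expect (embed hx (v x)) ψ = ((expect (embed hx (v x)) ψ).re : ℂ) :=
    Complex.ext rfl (by rw [expect_im_eq_zero hherm, Complex.ofReal_im])
  rw [h3, Complex.norm_real, Real.norm_eq_abs, abs_le]
  constructor <;> linarith

/-- For couplings in the polydisc `|s_x| ≤ a⁻¹` the Hamiltonian is still accretive: every site lies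
in at most `|B_R|` of the balls, so that the interaction costs at most `H⁰_S`. -/
theorem re_expect_coupledHam_nonneg (hh : ∀ x, (h x).PosSemidef) (hv : ∀ x, (v x).IsHermitian)
    {a : ℝ} (ha : 0 < a) (hrel : RelFormBounded h v a) {s : Site D → ℂ}
    (hs : ∀ x, ‖s x‖ ≤ a⁻¹) (S : Finset (Site D)) (ψ : LocalVec q S) :
    0 ≤ (expect (coupledHam h v s S) ψ).re := by
  set b : ℝ := ((ball R (0 : Site D)).card : ℝ) with hb
  have hb0 : 0 < b := Nat.cast_pos.2 (card_ball_pos D R)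
  set t : Site D → ℝ := fun z => (expect (siteTerm h S z) ψ).re with ht
  have ht0 : ∀ z, 0 ≤ t z := fun z =>
    (Complex.nonneg_iff.1 (expect_nonneg (posSemidef_siteTerm hh S z) ψ)).1
  set S' := S.filter fun x => ball R x ⊆ S with hS'
  have hterm : ∀ x ∈ S', -(b⁻¹ * ∑ z ∈ ball R x, t z) ≤
      (expect (if hx : ball R x ⊆ S then s x • embed hx (v x) else 0) ψ).re := by
    intro x hx
    have hxS := (Finset.mem_filter.1 hx).2
    rw [dif_pos hxS, expect_smul]
    have h1 := norm_expect_embed_le hh hv hrel hxS ψ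
    have h2 : ‖s x * expect (embed hxS (v x)) ψ‖ ≤ b⁻¹ * ∑ z ∈ ball R x, t z := by
      rw [norm_mul]
      calc _ ≤ a⁻¹ * (a / b * ∑ z ∈ ball R x, t z) := by
            gcongr
            exact hs x
        _ = _ := by field_simp
    have h3 := (abs_le.1 ((Complex.abs_re_le_norm _).trans h2)).1
    exact h3
  have hcount : ∑ x ∈ S', ∑ z ∈ ball R x, t z ≤ b * ∑ z ∈ S, t z := by
    rw [Finset.sum_comm' (t' := S) (s' := fun z => S'.filter fun x => z ∈ ball R x)]
    · rw [Finset.mul_sum]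
      refine Finset.sum_le_sum fun z _ => ?_
      rw [Finset.sum_const, nsmul_eq_mul]
      refine mul_le_mul_of_nonneg_right ?_ (ht0 z)
      rw [hb, ← card_ball R z]
      exact_mod_cast Finset.card_le_card fun x hx => mem_ball_comm.1 (Finset.mem_filter.1 hx).2
    · intro x z
      simp only [Finset.mem_filter, hS']
      constructor
      · rintro ⟨⟨h1, h2⟩, h3⟩
        exact ⟨⟨⟨h1, h2⟩, h3⟩, h2 h3⟩
      · rintro ⟨h1, _⟩
        exact h1
  rw [coupledHam, expect_add, freeHam_eq_sum, expect_sum, expect_sum, Complex.add_re,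
    Complex.re_sum, Complex.re_sum]
  have h4 : ∑ x ∈ S', (expect (if hx : ball R x ⊆ S then s x • embed hx (v x) else 0) ψ).re
      = ∑ x ∈ S, (expect (if hx : ball R x ⊆ S then s x • embed hx (v x) else 0) ψ).re := by
    refine Finset.sum_filter_of_ne fun x _ hx => ?_
    by_contra hn
    rw [dif_neg hn] at hx
    simp [expect] at hx
  rw [← h4]
  have h5 := Finset.sum_le_sum hterm
  rw [Finset.sum_neg_distrib, ← Finset.mul_sum] at h5
  have h6 := mul_le_mul_of_nonneg_left hcount (inv_nonneg.2 hb0.le)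
  rw [inv_mul_cancel_left₀ hb0.ne'] at h6
  change 0 ≤ ∑ z ∈ S, t z + _
  linarith

end Hamiltonian

/-! ### Traces relative to the free system -/

section RelTrace

open Matrix

variable {D q R : ℕ} {X S : Finset (Site D)}

/-- The unnormalized thermal expectation of `O` for couplings `s`, relative to the partition
function of the free system: `Tr(O e^{-βH_S(s)}) / Tr e^{-βH⁰_S}`. -/
noncomputable def relTrace (h : ∀ x : Site D, LocalOp q {x})
    (v : ∀ x : Site D, LocalOp q (ball R x)) (β : ℝ) (s : Site D → ℂ) (S : Finset (Site D))
    (O : LocalOp q S) : ℂ :=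
  (O * NormedSpace.exp (-(β : ℂ) • coupledHam h v s S)).trace /
    (NormedSpace.exp (-(β : ℂ) • freeHam h S)).trace

/-- `relTrace(AB) relTrace(1) - relTrace(A) relTrace(B)`, the covariance of `A` and `B` before
normalization. -/
noncomputable def relCov (h : ∀ x : Site D, LocalOp q {x})
    (v : ∀ x : Site D, LocalOp q (ball R x)) (β : ℝ) (s : Site D → ℂ) (S : Finset (Site D))
    (A B : LocalOp q S) : ℂ :=
  relTrace h v β s S (A * B) * relTrace h v β s S 1 - relTrace h v β s S A * relTrace h v β s S B

variable {h : ∀ x : Site D, LocalOp q {x}} {v : ∀ x : Site D, LocalOp q (ball R x)} {β : ℝ}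

theorem trace_mul_exp_embed_add (hXS : X ⊆ S) (P H : LocalOp q X) (Q K : LocalOp q (S \ X))
    (c : ℂ) :
    (embed hXS P * embed Finset.sdiff_subset Q *
      NormedSpace.exp (c • (embed hXS H + embed Finset.sdiff_subset K))).trace =
      (P * NormedSpace.exp (c • H)).trace * (Q * NormedSpace.exp (c • K)).trace := by
  let _ : NormedAlgebra ℚ (LocalOp q S) := NormedAlgebra.restrictScalars ℚ ℂ _
  rw [smul_add, ← embed_smul, ← embed_smul,
    NormedSpace.exp_add_of_commute (commute_embed_sdiff hXS _ _), ← embed_exp, ← embed_exp,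
    ← trace_embed_mul_embed_sdiff hXS, embed_mul, embed_mul,
    (commute_embed_sdiff hXS (NormedSpace.exp (c • H)) Q).symm.mul_mul_mul_comm]

theorem freeHam_split (hXS : X ⊆ S) :
    freeHam h S = embed hXS (freeHam h X) + embed Finset.sdiff_subset (freeHam h (S \ X)) := by
  rw [embed_freeHam, embed_freeHam, freeHam_eq_sum, add_comm, Finset.sum_sdiff hXS]

theorem trace_exp_freeHam_split (hXS : X ⊆ S) (c : ℂ) :
    (NormedSpace.exp (c • freeHam h S)).trace =
      (NormedSpace.exp (c • freeHam h X)).trace *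
        (NormedSpace.exp (c • freeHam h (S \ X))).trace := by
  have h1 := trace_mul_exp_embed_add hXS 1 (freeHam h X) 1 (freeHam h (S \ X)) c
  rwa [← freeHam_split hXS, embed_one, embed_one, one_mul, one_mul, one_mul, one_mul] at h1

theorem one_le_norm_trace_exp_freeHam (hgap : ∀ x, HasUnitGap (h x)) (β : ℝ)
    (S : Finset (Site D)) : 1 ≤ ‖(NormedSpace.exp (-(β : ℂ) • freeHam h S)).trace‖ := by
  induction hn : S.card generalizing S with
  | zero =>
    obtain rfl := Finset.card_eq_zero.1 hn
    have h0 : freeHam h (∅ : Finset (Site D)) = 0 := by rw [freeHam_eq_sum, Finset.sum_empty]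
    rw [h0, smul_zero, NormedSpace.exp_zero, trace_one]
    simp
  | succ n ih =>
    obtain ⟨x, hx⟩ : S.Nonempty := Finset.card_pos.1 (by omega)
    rw [trace_exp_freeHam_split (Finset.singleton_subset_iff.2 hx), norm_mul]
    have h1 : freeHam h {x} = h x := by
      rw [freeHam_eq_sum, Finset.sum_singleton, siteTerm, dif_pos subset_rfl, embed_self]
    obtain ⟨hpos, Ω, hΩ, hΩ0, -⟩ := hgap x
    refine one_le_mul_of_one_le_of_one_le ?_ (ih (S \ {x}) ?_)
    · rw [h1]
      exact one_le_norm_trace_exp hpos.1 hΩ ((hpos.dotProduct_mulVec_zero_iff Ω).1 hΩ0) β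
    · rw [Finset.card_sdiff_of_subset (Finset.singleton_subset_iff.2 hx), Finset.card_singleton]
      omega

theorem trace_exp_freeHam_ne_zero (hgap : ∀ x, HasUnitGap (h x)) (β : ℝ)
    (S : Finset (Site D)) : (NormedSpace.exp (-(β : ℂ) • freeHam h S)).trace ≠ 0 := fun h0 => by
  have h1 := one_le_norm_trace_exp_freeHam hgap β S
  rw [h0, norm_zero] at h1
  exact absurd h1 (by norm_num)

theorem relTrace_congr {s t : Site D → ℂ} (hst : ∀ x, ball R x ⊆ S → s x = t x)
    (O : LocalOp q S) : relTrace h v β s S O = relTrace h v β t S O := by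
  rw [relTrace, relTrace, coupledHam_congr hst]

theorem relTrace_one_eq_one (hgap : ∀ x, HasUnitGap (h x)) {s : Site D → ℂ}
    (hs : ∀ x, ball R x ⊆ S → s x = 0) : relTrace h v β s S 1 = 1 := by
  rw [relTrace, coupledHam_eq_freeHam hs, one_mul,
    div_self (trace_exp_freeHam_ne_zero hgap β S)]

/-- If no active interaction term couples `X` to `S ∖ X`, traces factorize. -/
theorem relTrace_split (hXS : X ⊆ S) {s : Site D → ℂ}
    (hs : ∀ x, s x ≠ 0 → ball R x ⊆ S → ball R x ⊆ X ∨ ball R x ⊆ S \ X)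
    (P : LocalOp q X) (Q : LocalOp q (S \ X)) :
    relTrace h v β s S (embed hXS P * embed Finset.sdiff_subset Q) =
      relTrace h v β s X P * relTrace h v β s (S \ X) Q := by
  rw [relTrace, coupledHam_split hXS hs, trace_mul_exp_embed_add, trace_exp_freeHam_split hXS,
    relTrace, relTrace, div_mul_div_comm]

/-- The part of the system that does not interact with `X` drops out. -/
theorem relTrace_embed (hgap : ∀ x, HasUnitGap (h x)) (hXS : X ⊆ S) {s : Site D → ℂ}
    (hs : ∀ x, s x ≠ 0 → ball R x ⊆ S → ball R x ⊆ X) (P : LocalOp q X) :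
    relTrace h v β s S (embed hXS P) = relTrace h v β s X P := by
  have h1 := relTrace_split (h := h) (v := v) (β := β) hXS (s := s)
    (fun x h0 hx => Or.inl (hs x h0 hx)) P 1
  rw [embed_one, mul_one] at h1
  rw [h1, relTrace_one_eq_one hgap, mul_one]
  intro x hx
  by_contra h0
  exact (Finset.mem_sdiff.1 (hx (mem_ball_self R x))).2
    (hs x h0 (hx.trans Finset.sdiff_subset) (mem_ball_self R x))

theorem relTrace_embed_sdiff (hgap : ∀ x, HasUnitGap (h x)) {s : Site D → ℂ}
    (hs : ∀ x, s x ≠ 0 → ball R x ⊆ S → ball R x ⊆ S \ X) (Q : LocalOp q (S \ X)) :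
    relTrace h v β s S (embed Finset.sdiff_subset Q) = relTrace h v β s (S \ X) Q :=
  relTrace_embed hgap _ hs Q

/-- If the interaction terms in `C` live in `X` and those in `C'` live in `S ∖ X`, then the
partition function of the latter splits off from any expectation in `X`. -/
theorem relTrace_indicator_union (hgap : ∀ x, HasUnitGap (h x)) (hXS : X ⊆ S)
    {C C' : Finset (Site D)} (hC : ∀ x ∈ C, ball R x ⊆ S → ball R x ⊆ X)
    (hC' : ∀ x ∈ C', ball R x ⊆ S → ball R x ⊆ S \ X) (P : LocalOp q X) :
    relTrace h v β (((C ∪ C' : Finset (Site D)) : Set (Site D)).indicator 1) S (embed hXS P) =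
      relTrace h v β ((C : Set (Site D)).indicator 1) S (embed hXS P) *
        relTrace h v β ((C' : Set (Site D)).indicator 1) S 1 := by
  have hne : ∀ {B : Finset (Site D)} {x : Site D},
      (B : Set (Site D)).indicator (1 : Site D → ℂ) x ≠ 0 → x ∈ B := by
    intro B x hx
    by_contra hn
    exact hx (Set.indicator_of_notMem (by simpa using hn) _)
  have hself : ∀ x : Site D, ¬ (ball R x ⊆ X ∧ ball R x ⊆ S \ X) := fun x hx =>
    (Finset.mem_sdiff.1 (hx.2 (mem_ball_self R x))).2 (hx.1 (mem_ball_self R x))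
  have h1 := relTrace_split (h := h) (v := v) (β := β) hXS
    (s := ((C ∪ C' : Finset (Site D)) : Set (Site D)).indicator 1)
    (fun x h0 hx => by
      rcases Finset.mem_union.1 (hne h0) with h1 | h1
      · exact Or.inl (hC x h1 hx)
      · exact Or.inr (hC' x h1 hx)) P 1
  rw [embed_one, mul_one] at h1
  rw [h1, relTrace_embed hgap hXS fun x h0 hx => hC x (hne h0) hx]
  have h2 := relTrace_embed_sdiff (h := h) (v := v) (β := β) hgap
    (s := (C' : Set (Site D)).indicator 1) (fun x h0 hx => hC' x (hne h0) hx) 1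
  rw [embed_one] at h2
  rw [h2]
  refine congrArg₂ (· * ·) (relTrace_congr (fun x hx => ?_) _) (relTrace_congr (fun x hx => ?_) _)
  · have hx' : x ∉ C' := fun h3 => hself x ⟨hx, hC' x h3 (hx.trans hXS)⟩
    simp [Set.indicator, hx']
  · have hx' : x ∉ C := fun h3 => hself x ⟨hC x h3 (hx.trans Finset.sdiff_subset), hx⟩
    simp [Set.indicator, hx']

/-- If `s` does not link the supports of two observables, their covariance vanishes. -/
theorem relCov_eq_zero (hXS : X ⊆ S) {s : Site D → ℂ}
    (hs : ∀ x, s x ≠ 0 → ball R x ⊆ S → ball R x ⊆ X ∨ ball R x ⊆ S \ X)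
    (P : LocalOp q X) (Q : LocalOp q (S \ X)) :
    relCov h v β s S (embed hXS P) (embed Finset.sdiff_subset Q) = 0 := by
  have h1 := relTrace_split (h := h) (v := v) (β := β) hXS hs P Q
  have h2 := relTrace_split (h := h) (v := v) (β := β) hXS hs P 1
  have h3 := relTrace_split (h := h) (v := v) (β := β) hXS hs 1 Q
  have h4 := relTrace_split (h := h) (v := v) (β := β) hXS hs 1 1
  rw [embed_one, mul_one] at h2
  rw [embed_one, one_mul] at h3
  rw [embed_one, embed_one, one_mul] at h4
  rw [relCov, h1, h2, h3, h4]
  ring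

/-- In the polydisc `|s_x| ≤ a⁻¹`, expectations are bounded by the dimension of the Hilbert space
of their support, uniformly in the temperature. -/
theorem norm_relTrace_embed_le (hgap : ∀ x, HasUnitGap (h x)) (hv : ∀ x, (v x).IsHermitian)
    {a : ℝ} (ha : 0 < a) (hrel : RelFormBounded h v a) (hβ : 0 ≤ β) (hXS : X ⊆ S)
    {s : Site D → ℂ} (hsa : ∀ x, ‖s x‖ ≤ a⁻¹)
    (hs : ∀ x, s x ≠ 0 → ball R x ⊆ S → ball R x ⊆ X) (P : LocalOp q X) :
    ‖relTrace h v β s S (embed hXS P)‖ ≤ ‖P‖ * (q : ℝ) ^ X.card := by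
  rw [relTrace_embed hgap hXS hs, relTrace, norm_div]
  refine (div_le_self (norm_nonneg _) (one_le_norm_trace_exp_freeHam hgap β X)).trans ?_
  refine (norm_trace_le _).trans ?_
  have hcard : (Fintype.card (Config q X) : ℝ) = (q : ℝ) ^ X.card := by simp
  rw [hcard, mul_comm]
  gcongr
  refine (norm_mul_le _ _).trans (mul_le_of_le_one_right (norm_nonneg _) ?_)
  exact norm_exp_le_one_of_re_nonneg _
    (re_expect_coupledHam_nonneg (fun x => (hgap x).1) hv ha hrel hsa X) hβ

theorem differentiable_relTrace (s : Site D → ℂ) (x : Site D) (O : LocalOp q S) :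
    Differentiable ℂ fun ζ => relTrace h v β (Function.update s x ζ) S O := by
  unfold relTrace
  refine Differentiable.div_const ?_ _
  have hH : Differentiable ℂ fun ζ =>
      -(β : ℂ) • coupledHam h v (Function.update s x ζ) S := by
    suffices hV : Differentiable ℂ fun ζ : ℂ => ∑ y ∈ S, if hy : ball R y ⊆ S then
        Function.update s x ζ y • embed hy (v y) else 0 from
      (hV.const_add (freeHam h S)).const_smul (-(β : ℂ))
    refine Differentiable.fun_sum fun y _ => ?_
    split_ifs with hy
    · refine Differentiable.smul_const ?_ _
      by_cases hyx : y = x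
      · subst hyx; simp only [Function.update_self]; exact differentiable_id
      · simp only [Function.update_of_ne hyx]; exact differentiable_const _
    · exact differentiable_const _
  have hexp : Differentiable ℂ fun ζ =>
      O * NormedSpace.exp (-(β : ℂ) • coupledHam h v (Function.update s x ζ) S) := by
    refine Differentiable.const_mul ?_ _
    intro ζ
    exact (NormedSpace.exp_analytic (𝕂 := ℂ) _).differentiableAt.comp ζ (hH ζ)
  let T : LocalOp q S →L[ℂ] ℂ :=
    LinearMap.toContinuousLinearMap (Matrix.traceLinearMap (Config q S) ℂ ℂ)
  exact T.differentiable.comp hexp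

end RelTrace

/-! ### The cluster expansion -/

section Cluster

variable {D q R : ℕ} {X Y S : Finset (Site D)}
  {h : ∀ x : Site D, LocalOp q {x}} {v : ∀ x : Site D, LocalOp q (ball R x)} {β : ℝ}

theorem notMem_ball_of_siteDist {x y z : Site D} (hxy : y ∉ ball (2 * R) x) (hz : z ∈ ball R x) :
    z ∉ ball R y := by
  intro hzy
  refine hxy ((mem_ball _ _ _).2 ?_)
  have h1 := (mem_ball _ _ _).1 hz
  have h2 := (mem_ball _ _ _).1 hzy
  rw [siteDist_comm] at h2
  have := siteDist_triangle x z y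
  omega

theorem card_biUnion_ball_le (C : Finset (Site D)) (R : ℕ) :
    (C.biUnion (ball R)).card ≤ (ball R (0 : Site D)).card * C.card := by
  rw [mul_comm]
  exact Finset.card_biUnion_le_card_mul _ _ _ fun x _ => (card_ball R x).le

/-- Expectations of an observable on `X` factorize over interaction terms that are far from `X`
and from all the other terms. -/
theorem relTrace_union (hgap : ∀ x, HasUnitGap (h x)) (hXS : X ⊆ S) {C C' : Finset (Site D)}
    (hCX : ∀ y ∈ C', y ∉ X.biUnion (ball R)) (hCC' : ∀ y ∈ C', ∀ x ∈ C, y ∉ ball (2 * R) x)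
    (P : LocalOp q X) :
    relTrace h v β (((C ∪ C' : Finset (Site D)) : Set (Site D)).indicator 1) S (embed hXS P) =
      relTrace h v β ((C : Set (Site D)).indicator 1) S (embed hXS P) *
        relTrace h v β ((C' : Set (Site D)).indicator 1) S 1 := by
  have hXT : X ⊆ S \ C'.biUnion (ball R) := by
    intro z hz
    refine Finset.mem_sdiff.2 ⟨hXS hz, fun hz' => ?_⟩
    obtain ⟨y, hy, hzy⟩ := Finset.mem_biUnion.1 hz'
    exact hCX y hy (Finset.mem_biUnion.2 ⟨z, hz, mem_ball_comm.1 hzy⟩)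
  have hTS : S \ C'.biUnion (ball R) ⊆ S := Finset.sdiff_subset
  rw [← embed_embed hXT hTS]
  refine relTrace_indicator_union hgap hTS (fun x hx hxS z hz => ?_) (fun y hy hyS z hz => ?_) _
  · refine Finset.mem_sdiff.2 ⟨hxS hz, fun hz' => ?_⟩
    obtain ⟨y, hy, hzy⟩ := Finset.mem_biUnion.1 hz'
    exact notMem_ball_of_siteDist (hCC' y hy x hx) hz hzy
  · exact Finset.mem_sdiff.2 ⟨hyS hz, fun hz' =>
      (Finset.mem_sdiff.1 hz').2 (Finset.mem_biUnion.2 ⟨y, hy, hz⟩)⟩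

theorem relTrace_one_union (hgap : ∀ x, HasUnitGap (h x)) {C C' : Finset (Site D)}
    (hCC' : ∀ y ∈ C', ∀ x ∈ C, y ∉ ball (2 * R) x) :
    relTrace h v β (((C ∪ C' : Finset (Site D)) : Set (Site D)).indicator 1) S 1 =
      relTrace h v β ((C : Set (Site D)).indicator 1) S 1 *
        relTrace h v β ((C' : Set (Site D)).indicator 1) S 1 := by
  have h1 := relTrace_union (v := v) (β := β) hgap (Finset.empty_subset S) (C := C) (C' := C')
    (by simp) hCC' 1
  rwa [embed_one] at h1

theorem relCov_union (hgap : ∀ x, HasUnitGap (h x)) (hXS : X ⊆ S) {C C' : Finset (Site D)}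
    (hCX : ∀ y ∈ C', y ∉ X.biUnion (ball R)) (hCC' : ∀ y ∈ C', ∀ x ∈ C, y ∉ ball (2 * R) x)
    (A B : LocalOp q X) :
    relCov h v β (((C ∪ C' : Finset (Site D)) : Set (Site D)).indicator 1) S
        (embed hXS A) (embed hXS B) =
      relCov h v β ((C : Set (Site D)).indicator 1) S (embed hXS A) (embed hXS B) *
        relTrace h v β ((C' : Set (Site D)).indicator 1) S 1 ^ 2 := by
  unfold relCov
  rw [← embed_mul, relTrace_union hgap hXS hCX hCC', relTrace_union hgap hXS hCX hCC',
    relTrace_union hgap hXS hCX hCC', relTrace_one_union hgap hCC']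
  ring

/-- In the polydisc `|s_x| ≤ a⁻¹`, with the couplings outside `C` switched off, expectations are
bounded exponentially in `|X|` and `|C|`. -/
theorem norm_relTrace_le (hgap : ∀ x, HasUnitGap (h x)) (hv : ∀ x, (v x).IsHermitian)
    {a : ℝ} (ha : 0 < a) (hrel : RelFormBounded h v a) (hβ : 0 ≤ β) (hXS : X ⊆ S)
    {s : Site D → ℂ} (hsa : ∀ x, ‖s x‖ ≤ a⁻¹) {C : Finset (Site D)} (hC : ∀ x ∉ C, s x = 0)
    (P : LocalOp q X) :
    ‖relTrace h v β s S (embed hXS P)‖ ≤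
      ‖P‖ * ((q : ℝ) + 1) ^ (X.card + (ball R (0 : Site D)).card * C.card) := by
  set T := S ∩ (X ∪ C.biUnion (ball R)) with hT
  have hXT : X ⊆ T := Finset.subset_inter hXS Finset.subset_union_left
  have hTS : T ⊆ S := Finset.inter_subset_left
  rw [← embed_embed hXT hTS]
  refine (norm_relTrace_embed_le hgap hv ha hrel hβ hTS hsa (fun x hx hxS => ?_) _).trans ?_
  · have hxC : x ∈ C := by
      by_contra hn
      exact hx (hC x hn)
    exact Finset.subset_inter hxS
      ((Finset.subset_biUnion_of_mem (ball R) hxC).trans Finset.subset_union_right)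
  · have hcard : T.card ≤ X.card + (ball R (0 : Site D)).card * C.card :=
      (Finset.card_le_card Finset.inter_subset_right).trans
        ((Finset.card_union_le _ _).trans
          (Nat.add_le_add_left (card_biUnion_ball_le C R) _))
    have hq : (q : ℝ) ^ T.card ≤ ((q : ℝ) + 1) ^ T.card := by gcongr; linarith
    refine mul_le_mul (norm_embed_le _ _) (hq.trans ?_) (by positivity) (norm_nonneg _)
    exact pow_le_pow_right₀ (by linarith [(Nat.cast_nonneg q : (0 : ℝ) ≤ q)]) hcard

theorem norm_one_localOp_empty_le (D q : ℕ) : ‖(1 : LocalOp q (∅ : Finset (Site D)))‖ ≤ 1 :=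
  norm_one.le

theorem norm_relTrace_one_le (hgap : ∀ x, HasUnitGap (h x)) (hv : ∀ x, (v x).IsHermitian)
    {a : ℝ} (ha : 0 < a) (hrel : RelFormBounded h v a) (hβ : 0 ≤ β)
    {s : Site D → ℂ} (hsa : ∀ x, ‖s x‖ ≤ a⁻¹) {C : Finset (Site D)} (hC : ∀ x ∉ C, s x = 0) :
    ‖relTrace h v β s S 1‖ ≤ ((q : ℝ) + 1) ^ ((ball R (0 : Site D)).card * C.card) := by
  have h1 := norm_relTrace_le hgap hv ha hrel hβ (Finset.empty_subset S) hsa hC 1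
  rw [embed_one, Finset.card_empty, zero_add] at h1
  exact h1.trans (mul_le_of_le_one_left (by positivity) (norm_one_localOp_empty_le D q))

theorem norm_relCov_le (hgap : ∀ x, HasUnitGap (h x)) (hv : ∀ x, (v x).IsHermitian)
    {a : ℝ} (ha : 0 < a) (hrel : RelFormBounded h v a) (hβ : 0 ≤ β) (hXS : X ⊆ S)
    {s : Site D → ℂ} (hsa : ∀ x, ‖s x‖ ≤ a⁻¹) {C : Finset (Site D)} (hC : ∀ x ∉ C, s x = 0)
    (A B : LocalOp q X) :
    ‖relCov h v β s S (embed hXS A) (embed hXS B)‖ ≤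
      2 * ‖A‖ * ‖B‖ * ((q : ℝ) + 1) ^ (2 * X.card) *
        (((q : ℝ) + 1) ^ (2 * (ball R (0 : Site D)).card)) ^ C.card := by
  set Q : ℝ := (q : ℝ) + 1
  have hQ : 1 ≤ Q := le_add_of_nonneg_left (Nat.cast_nonneg q)
  set m := (ball R (0 : Site D)).card * C.card with hm
  have h1 := norm_relTrace_le hgap hv ha hrel hβ hXS hsa hC (A * B)
  have h2 := norm_relTrace_le hgap hv ha hrel hβ hXS hsa hC A
  have h3 := norm_relTrace_le hgap hv ha hrel hβ hXS hsa hC B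
  have h4 : ‖relTrace h v β s S 1‖ ≤ Q ^ (X.card + m) :=
    (norm_relTrace_one_le hgap hv ha hrel hβ hsa hC).trans
      (pow_le_pow_right₀ hQ (Nat.le_add_left _ _))
  have hAB : ‖A * B‖ ≤ ‖A‖ * ‖B‖ := norm_mul_le _ _
  rw [embed_mul] at h1
  have hQm : 0 ≤ Q ^ (X.card + m) := by positivity
  have h5 := mul_le_mul (h1.trans (mul_le_mul_of_nonneg_right hAB hQm)) h4 (norm_nonneg _)
    (mul_nonneg (mul_nonneg (norm_nonneg A) (norm_nonneg B)) hQm)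
  have h6 := mul_le_mul h2 h3 (norm_nonneg _) (mul_nonneg (norm_nonneg A) hQm)
  rw [← norm_mul] at h5 h6
  refine (norm_sub_le _ _).trans ((add_le_add h5 h6).trans (le_of_eq ?_))
  rw [← pow_mul Q, mul_assoc 2 _ C.card, ← hm, pow_add, pow_mul' _ 2, pow_mul' _ 2]
  ring

/-- Interaction terms that are too few to bridge the distance between `X` and `Y` leave a cut
between these sets. The candidates are the sets of points at distance less than `t` from `X`,
with `1 ≤ t ≤ n`; each ball is cut by at most `2R` of them. -/
theorem exists_cut (hXS : X ⊆ S) (hYS : Y ⊆ S) (C : Finset (Site D)) {n : ℕ}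
    (hn : (n : ℕ∞) ≤ setDist X Y) (hC : 2 * R * C.card < n) :
    ∃ T ⊆ S, X ⊆ T ∧ Y ⊆ S \ T ∧
      ∀ x ∈ C, ball R x ⊆ S → ball R x ⊆ T ∨ ball R x ⊆ S \ T := by
  classical
  set m : Site D → ℕ := fun x => sInf {k | ∃ u ∈ X, siteDist u x < k} with hm
  obtain ⟨t, ht, htC⟩ : ∃ t ∈ Finset.Icc 1 n,
      t ∉ C.biUnion fun x => Finset.Ico (m x - R) (m x + R) := by
    refine Finset.exists_mem_notMem_of_card_lt_card ?_
    rw [Nat.card_Icc, Nat.add_sub_cancel]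
    refine lt_of_le_of_lt (Finset.card_biUnion_le_card_mul _ _ (2 * R) fun x _ => ?_)
      (by rwa [mul_comm])
    rw [Nat.card_Ico]
    omega
  rw [Finset.mem_Icc] at ht
  refine ⟨S.filter fun z => ∃ u ∈ X, siteDist u z < t, Finset.filter_subset _ _,
    fun u hu => ?_, fun y hy => ?_, fun x hx hxS => ?_⟩
  · exact Finset.mem_filter.2 ⟨hXS hu, u, hu, by rw [siteDist_self]; omega⟩
  · refine Finset.mem_sdiff.2 ⟨hYS hy, fun hyT => ?_⟩
    obtain ⟨u, hu, hut⟩ := (Finset.mem_filter.1 hyT).2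
    have h1 : (n : ℕ∞) ≤ siteDist u y := hn.trans (iInf₂_le_of_le u hu (iInf₂_le y hy))
    have h2 : n ≤ siteDist u y := by exact_mod_cast h1
    omega
  · by_contra! hcut
    obtain ⟨z', hz', hz'T⟩ := Finset.not_subset.1 hcut.1
    obtain ⟨z, hz, hzT⟩ := Finset.not_subset.1 hcut.2
    have hzT' : z ∈ S.filter fun z => ∃ u ∈ X, siteDist u z < t := by
      by_contra hzn
      exact hzT (Finset.mem_sdiff.2 ⟨hxS hz, hzn⟩)
    obtain ⟨u, hu, hut⟩ := (Finset.mem_filter.1 hzT').2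
    have hzx := (mem_ball _ _ _).1 hz
    have hz'x := (mem_ball _ _ _).1 hz'
    refine htC (Finset.mem_biUnion.2 ⟨x, hx, Finset.mem_Ico.2 ⟨?_, ?_⟩⟩)
    · have h1 : m x ≤ t + R := Nat.sInf_le ⟨u, hu, by
        have := siteDist_triangle u z x
        rw [siteDist_comm z x] at this
        omega⟩
      omega
    · obtain ⟨u', hu', hlt⟩ : m x ∈ {k | ∃ u ∈ X, siteDist u x < k} :=
        Nat.sInf_mem ⟨_, u, hu, Nat.lt_succ_self _⟩
      by_contra hge
      refine hz'T (Finset.mem_filter.2 ⟨hxS hz', u', hu', ?_⟩)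
      have := siteDist_triangle u' x z'
      omega

theorem relCov_indicator_eq_zero (hXS : X ⊆ S) (hYS : Y ⊆ S) {C : Finset (Site D)} {n : ℕ}
    (hn : (n : ℕ∞) ≤ setDist X Y) (hC : 2 * R * C.card < n) (A : LocalOp q X)
    (B : LocalOp q Y) :
    relCov h v β ((C : Set (Site D)).indicator 1) S (embed hXS A) (embed hYS B) = 0 := by
  obtain ⟨T, hTS, hXT, hYT, hcut⟩ := exists_cut (R := R) hXS hYS C hn hC
  rw [← embed_embed hXT hTS, ← embed_embed hYT Finset.sdiff_subset]
  refine relCov_eq_zero hTS (fun x hx hxS => hcut x ?_ hxS) _ _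
  by_contra hxC
  exact hx (Set.indicator_of_notMem (by simpa using hxC) _)

/-- The covariance in the Gibbs state is `relCov`, normalized by the square of the partition
function. -/
theorem cov_gibbs_eq (hgap : ∀ x, HasUnitGap (h x))
    (hZ : relTrace h v β 1 S 1 ≠ 0) (A B : LocalOp q S) :
    cov (gibbs β (ham h v S)) A B = relCov h v β 1 S A B / relTrace h v β 1 S 1 ^ 2 := by
  have h0 := trace_exp_freeHam_ne_zero hgap β S
  unfold cov gibbs relCov
  unfold relTrace at hZ ⊢
  rw [coupledHam_one] at *
  rw [one_mul] at *
  have h1 : (NormedSpace.exp (-(β : ℂ) • ham h v S)).trace ≠ 0 := fun h2 => hZ (by rw [h2, zero_div])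
  simp only [Matrix.mul_smul, Matrix.trace_smul, smul_eq_mul]
  field_simp

theorem expDecay_nonneg (c : ℝ) (d : ℕ∞) : 0 ≤ expDecay c d := by
  cases d with
  | top => exact le_rfl
  | coe n => exact (Real.exp_pos _).le

/-- Decay of correlations, with explicit conditions on `a`. -/
theorem norm_cov_gibbs_le (hgap : ∀ x, HasUnitGap (h x)) (hv : ∀ x, (v x).IsHermitian)
    {a κ : ℝ} (ha : 0 < a) (ha1 : a < 1) (hrel : RelFormBounded h v a) (hβ : 0 ≤ β)
    (hκ0 : 0 ≤ κ) (hκ : κ * 8 ^ (ball (2 * R) (0 : Site D)).card ≤ 1 / 2)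
    (haκ : 2 * ((q : ℝ) + 1) ^ (2 * (ball R (0 : Site D)).card) * a ≤ κ * Real.exp (-1))
    (hX : X ⊆ S) (hY : Y ⊆ S) (A : LocalOp q X) (B : LocalOp q Y) :
    ‖cov (gibbs β (ham h v S)) (embed hX A) (embed hY B)‖ ≤
      2 * ‖A‖ * ‖B‖ * (((q : ℝ) + 1) ^ 2 * 8 ^ (ball R (0 : Site D)).card) ^ (X.card + Y.card) *
        expDecay (2 * (R : ℝ) + 1)⁻¹ (setDist X Y) := by
  set Q : ℝ := (q : ℝ) + 1 with hQdef
  have hQ : 1 ≤ Q := le_add_of_nonneg_left (Nat.cast_nonneg q)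
  set b := (ball R (0 : Site D)).card with hb
  set Δ := (ball (2 * R) (0 : Site D)).card with hΔ
  set d := expDecay (2 * (R : ℝ) + 1)⁻¹ (setDist X Y) with hd
  have hd0 : 0 ≤ d := expDecay_nonneg _ _
  have hr : 1 < a⁻¹ := (one_lt_inv₀ ha).2 ha1
  set Z : Finset (Site D) → ℂ := fun C =>
    relTrace h v β ((C : Set (Site D)).indicator 1) S 1 with hZ
  set Φ : Finset (Site D) → ℂ := fun C =>
    relCov h v β ((C : Set (Site D)).indicator 1) S (embed hX A) (embed hY B) with hΦ
  -- Dobrushin's estimate for the partition function.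
  have hZdiff : ∀ C, ‖mixedDiff Z C ∅‖ ≤ κ ^ C.card := by
    intro C
    have h1 := norm_mixedDiff_indicator_le (G := fun s => relTrace h v β s S 1) (M := 1)
      (c := Q ^ b) hr C (fun s x => differentiable_relTrace s x 1)
      (fun s hs C' hC' hs0 => by
        rw [one_mul, ← pow_mul]
        exact (norm_relTrace_one_le hgap hv ha hrel hβ hs hs0).trans
          (pow_le_pow_right₀ hQ (Nat.mul_le_mul_left _ (Finset.card_le_card hC'))))
    refine h1.trans ?_
    rw [one_mul, inv_inv]
    refine pow_le_pow_left₀ (by positivity) ?_ _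
    calc 2 * Q ^ b * a ≤ 2 * Q ^ (2 * b) * a := by
          gcongr
          omega
      _ ≤ κ * Real.exp (-1) := haκ
      _ ≤ κ := mul_le_of_le_one_right hκ0 (Real.exp_le_one_iff.2 (by norm_num))
  have hZratio : ∀ C, ∀ x ∈ C, ‖Z (C.erase x)‖ ≤ 2 * ‖Z C‖ :=
    norm_erase_le (ball (2 * R)) (fun x => (card_ball (2 * R) x).le) hκ0 hκ
      (fun C C' hCC' => relTrace_one_union hgap hCC') hZdiff
  have hZne : ∀ C, Z C ≠ 0 := by
    intro C
    induction C using Finset.induction_on with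
    | empty =>
      have : Z ∅ = 1 := relTrace_one_eq_one hgap (by simp)
      rw [this]
      exact one_ne_zero
    | insert x C hx ih =>
      intro h0
      have h1 := hZratio (insert x C) x (Finset.mem_insert_self _ _)
      rw [Finset.erase_insert hx, h0, norm_zero, mul_zero] at h1
      exact ih (norm_le_zero_iff.1 h1)
  -- The observables are regarded as operators on `W = X ∪ Y`.
  set W := X ∪ Y with hW
  have hWS : W ⊆ S := Finset.union_subset hX hY
  have hA : embed hX A = embed hWS (embed Finset.subset_union_left A) := (embed_embed _ _ _).symm
  have hB : embed hY B = embed hWS (embed Finset.subset_union_right B) := (embed_embed _ _ _).symm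
  have hWcard : W.card ≤ X.card + Y.card := Finset.card_union_le _ _
  set M : ℝ := 2 * ‖A‖ * ‖B‖ * Q ^ (2 * (X.card + Y.card)) with hM
  have hM0 : 0 ≤ M := by positivity
  -- Mixed differences of the covariance vanish unless there are enough terms to link `X` to `Y`.
  have hΦdiff : ∀ C, ‖mixedDiff Φ C ∅‖ ≤ M * d * κ ^ C.card := by
    intro C
    by_cases hlink : ∃ n : ℕ, (n : ℕ∞) ≤ setDist X Y ∧ 2 * R * C.card < n
    · obtain ⟨n, hn, hC⟩ := hlink
      have h1 : ‖mixedDiff Φ C ∅‖ ≤ 2 ^ C.card * 0 :=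
        norm_mixedDiff_le_of_forall fun C' hC' => by
          have h2 : Φ C' = 0 := relCov_indicator_eq_zero hX hY hn
            ((Nat.mul_le_mul_left _ (Finset.card_le_card hC')).trans_lt hC) A B
          rw [h2, norm_zero]
      rw [mul_zero] at h1
      exact h1.trans (by positivity)
    · push Not at hlink
      have hfin : setDist X Y ≠ ⊤ := by
        intro htop
        have h2 := hlink (2 * R * C.card + 1) (by rw [htop]; exact le_top)
        omega
      obtain ⟨n, hn⟩ := ENat.ne_top_iff_exists.1 hfin
      have hnC := hlink n hn.le
      have h1 := norm_mixedDiff_indicator_le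
        (G := fun s => relCov h v β s S (embed hX A) (embed hY B)) (M := M)
        (c := Q ^ (2 * b)) hr C
        (fun s x => ((differentiable_relTrace s x _).mul (differentiable_relTrace s x _)).sub
          ((differentiable_relTrace s x _).mul (differentiable_relTrace s x _)))
        (fun s hs C' hC' hs0 => by
          rw [hA, hB]
          refine (norm_relCov_le hgap hv ha hrel hβ hWS hs hs0 _ _).trans ?_
          rw [hM]
          gcongr
          · exact norm_embed_le _ _
          · exact norm_embed_le _ _
          · exact one_le_pow₀ hQ)
      refine h1.trans ?_
      rw [inv_inv, mul_assoc M]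
      refine mul_le_mul_of_nonneg_left ?_ hM0
      calc (2 * Q ^ (2 * b) * a) ^ C.card ≤ (κ * Real.exp (-1)) ^ C.card := by gcongr
        _ = Real.exp (-C.card) * κ ^ C.card := by
            rw [mul_pow, ← Real.exp_nat_mul, mul_comm]
            ring_nf
        _ ≤ d * κ ^ C.card := by
            refine mul_le_mul_of_nonneg_right ?_ (by positivity)
            rw [hd, ← hn]
            change _ ≤ Real.exp (-(2 * (R : ℝ) + 1)⁻¹ * n)
            refine Real.exp_le_exp.2 ?_
            have h3 : (n : ℝ) ≤ 2 * R * C.card := by exact_mod_cast hnC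
            have h4 : (2 * (R : ℝ) + 1)⁻¹ * n ≤ C.card := by
              rw [inv_mul_le_iff₀ (by positivity)]
              have : (0 : ℝ) ≤ C.card := Nat.cast_nonneg _
              nlinarith
            linarith
  have hmain := norm_mixedDiff_le (ball (2 * R)) (fun x => (card_ball (2 * R) x).le)
    (Z := fun C => Z C ^ 2) (Φ := Φ) (M := M * d) (N₀ := W.biUnion (ball R)) hκ0
    (mul_nonneg hM0 hd0) (hκ.trans (by norm_num))
    (fun C C' hCC' => by
      simp only [hΦ, hA, hB]
      exact relCov_union hgap hWS (fun y hy => (hCC' y hy).1) (fun y hy => (hCC' y hy).2) _ _)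
    hΦdiff S
    (fun C _ x hx => by
      rw [norm_pow, norm_pow]
      calc ‖Z (C.erase x)‖ ^ 2 ≤ (2 * ‖Z C‖) ^ 2 := by gcongr; exact hZratio C x hx
        _ = 4 * ‖Z C‖ ^ 2 := by ring)
    ∅ (W.biUnion (ball R)) (Finset.disjoint_empty_left _) (fun y _ hy => ⟨hy, by simp⟩)
  rw [mixedDiff_empty, Finset.card_empty, pow_zero, mul_one] at hmain
  -- Inside `S` all couplings are equal to `1`.
  have hone : ∀ O : LocalOp q S,
      relTrace h v β ((S : Set (Site D)).indicator 1) S O = relTrace h v β 1 S O := fun O =>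
    relTrace_congr (fun x hx => Set.indicator_of_mem (by simpa using hx (mem_ball_self R x)) _) O
  have hZS : Z S = relTrace h v β 1 S 1 := hone 1
  have hΦS : Φ S = relCov h v β 1 S (embed hX A) (embed hY B) := by
    simp only [hΦ, relCov, hone]
  have hZ1 : relTrace h v β 1 S 1 ≠ 0 := hZS ▸ hZne S
  rw [cov_gibbs_eq hgap hZ1, norm_div, div_le_iff₀ (norm_pos_iff.2 (pow_ne_zero 2 hZ1)), ← hΦS,
    ← hZS]
  refine hmain.trans (mul_le_mul_of_nonneg_right ?_ (norm_nonneg _))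
  have hcard : (W.biUnion (ball R)).card ≤ b * (X.card + Y.card) :=
    (card_biUnion_ball_le W R).trans (Nat.mul_le_mul_left _ hWcard)
  calc M * d * 8 ^ (W.biUnion (ball R)).card ≤ M * d * 8 ^ (b * (X.card + Y.card)) := by
        gcongr
        norm_num
    _ = _ := by
        rw [hM, mul_pow, ← pow_mul, ← pow_mul]
        ring

end Cluster

end QuantumLattice

theorem theorem2p1 (D q R : ℕ) (Cint : ℝ) (hCint : 0 < Cint) :
    ∃ a C₁ C₂ C₃ : ℝ, 0 < a ∧ a < 1 ∧ 0 < C₁ ∧ 0 < C₂ ∧ 0 < C₃ ∧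
      ∀ (Λ : Finset (QuantumLattice.Site D))
        (h : ∀ x : QuantumLattice.Site D, QuantumLattice.LocalOp q {x})
        (v : ∀ x : QuantumLattice.Site D, QuantumLattice.LocalOp q (QuantumLattice.ball R x)),
        (∀ x, QuantumLattice.HasUnitGap (h x)) →
        (∀ x, (v x).IsHermitian) →
        (∀ x, ‖h x‖ ≤ Cint) →
        (∀ x, ‖v x‖ ≤ Cint) →
        QuantumLattice.RelFormBounded h v a →
        ∀ β : ℝ, 0 < β →
        ∀ (X Y : Finset (QuantumLattice.Site D)) (hX : X ⊆ Λ) (hY : Y ⊆ Λ)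
          (A : QuantumLattice.LocalOp q X) (B : QuantumLattice.LocalOp q Y),
          ‖QuantumLattice.cov (QuantumLattice.gibbs β (QuantumLattice.ham h v Λ))
              (QuantumLattice.embed hX A) (QuantumLattice.embed hY B)‖ ≤
            C₁ * ‖A‖ * ‖B‖ * Real.exp (C₂ * ((X.card : ℝ) + (Y.card : ℝ))) *
              QuantumLattice.expDecay C₃ (QuantumLattice.setDist X Y) := by
  set Q : ℝ := (q : ℝ) + 1 with hQdef
  have hQ : 1 ≤ Q := le_add_of_nonneg_left (Nat.cast_nonneg q)
  set b := (QuantumLattice.ball R (0 : QuantumLattice.Site D)).card with hb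
  set Δ := (QuantumLattice.ball (2 * R) (0 : QuantumLattice.Site D)).card with hΔ
  set κ : ℝ := 1 / 2 / 8 ^ Δ with hκ
  have hκ0 : 0 < κ := by positivity
  set E : ℝ := Q ^ 2 * 8 ^ b with hE
  have hE1 : 1 < E :=
    one_lt_mul_of_le_of_lt (one_le_pow₀ hQ)
      (one_lt_pow₀ (by norm_num) (QuantumLattice.card_ball_pos D R).ne')
  have hden : 0 < 2 * Q ^ (2 * b) := by positivity
  have ha1 : κ * Real.exp (-1) / (2 * Q ^ (2 * b)) < 1 := by
    rw [div_lt_one hden]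
    have h1 : κ ≤ 1 / 2 := div_le_self (by norm_num) (one_le_pow₀ (by norm_num))
    have h2 : Real.exp (-1) ≤ 1 := Real.exp_le_one_iff.2 (by norm_num)
    have h3 : 1 ≤ Q ^ (2 * b) := one_le_pow₀ hQ
    have h4 : κ * Real.exp (-1) ≤ 1 / 2 * 1 := by gcongr
    linarith
  -- `κ` makes Dobrushin's induction close, and the extra factor `exp (-1)` in `a` yields the decay
  -- by `exp (-1)` per interaction term; a term bridges a distance of at most `2 * R`.
  refine ⟨κ * Real.exp (-1) / (2 * Q ^ (2 * b)), 2, Real.log E, (2 * (R : ℝ) + 1)⁻¹,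
    by positivity, ha1, two_pos, Real.log_pos hE1, by positivity, ?_⟩
  intro Λ h v hgap hv _ _ hrel β hβ X Y hX hY A B
  have hexp : Real.exp (Real.log E * ((X.card : ℝ) + (Y.card : ℝ))) = E ^ (X.card + Y.card) := by
    rw [mul_comm, ← Nat.cast_add, Real.exp_nat_mul, Real.exp_log (one_pos.trans hE1)]
  rw [hexp]
  exact QuantumLattice.norm_cov_gibbs_le hgap hv (by positivity) ha1 hrel hβ.le hκ0.le
    (div_mul_cancel₀ _ (by positivity)).le (mul_div_cancel₀ _ hden.ne').le hX hY A B
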